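/- Let $R=\mathbb{Z}[t]/(t^4)$. Call a (unital) subring $S$ of finite index in $R$ cocyclic if the finite abelian group $R/S$ is cyclic, and let $a(k)$ be the (finite) number of cocyclic subrings of index $k$. Put $\zeta_R^{cc}(s)=\sum_{k\ge1}a(k)k^{-s}$ and, for a prime $p$, $\zeta_{R,p}^{cc}(s)=\sum_{m\ge0}a(p^m)p^{-ms}$. Then: (1) For every odd prime $p$ and $\Re s>1$ the series $\zeta_{R,p}^{cc}(s)$ converges absolutely and, with $x=p^{-s}$, $$\zeta_{R,p}^{cc}(s)=\frac{1+x+(p^3-p^2)x^3-p^3x^4-p^4x^5}{(1-p^2x^2)(1-p^4x^4)}.$$ For $p=2$ and $\Re s>1$ the series converges absolutely and, with $x=2^{-s}$, $$\zeta_{R,2}^{cc}(s)=\frac{1+x+2^2x^2-2^3x^4-2^4x^5+2^7x^8+2^{10}x^{10}}{(1-2^4x^4)(1-2^3x^3)}.$$ (2) The series $\zeta_R^{cc}(s)$ converges absolutely for $\Re s>3/2$. For some $\delta>0$ it continues meromorphically to $\Re s>3/2-\delta$, where it has a simple pole at $s=3/2$ and no other singularity. (3) The product $P=\prod_{p\ne2}\left(1+2p^{-3/2}-p^{-5/2}-p^{-3}-p^{-7/2}\right)$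 over the odd primes converges, and as $T\to\infty$ $$\sum_{k\le T}a(k)\sim \zeta(2)\,(A+B\sqrt2)\,P\;T^{3/2},\qquad A=\tfrac{7}{24},\quad B=\tfrac{5}{48},\qquad A+B\sqrt2=\tfrac18\,\zeta_{R,2}^{cc}(3/2).$$ If only odd indices are counted, the $2$-adic factor drops out: $$\sum_{k\le T,\ k\text{ odd}}a(k)\sim \tfrac18\,\zeta(2)\,P\;T^{3/2}.$$ -/

import Mathlib

open Polynomial Asymptotics Filter

/-- The ring `R = ℤ[t]/(t⁴)`. -/
abbrev TruncRing : Type := ℤ[X] ⧸ Ideal.span {(X : ℤ[X]) ^ 4}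

/-- The index `[R : S]` of the additive group of a (unital) subring `S` of `R`
(it is `0` when the index is infinite). -/
noncomputable def subringIndex (S : Subring TruncRing) : ℕ :=
  S.toAddSubgroup.index

/-- A subring `S` of `R` is cocyclic if it has finite index in `R` and the finite abelian group
`R/S` is cyclic. -/
def IsCocyclic (S : Subring TruncRing) : Prop :=
  S.toAddSubgroup.FiniteIndex ∧ IsAddCyclic (TruncRing ⧸ S.toAddSubgroup)

/-- The set of cocyclic subrings of `R` of index `k`. -/
def cocyclicSubrings (k : ℕ) : Set (Subring TruncRing) :=
  {S | IsCocyclic S ∧ subringIndex S = k}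

/-- `a_R^{cc}(k)`: the number of cocyclic subrings of `R` of index `k`. -/
noncomputable def cocyclicCount (k : ℕ) : ℕ :=
  (cocyclicSubrings k).ncard

/-- The Dirichlet series `ζ_R^{cc}(s) = ∑_{k ≥ 1} a_R^{cc}(k) k^{-s}`. -/
noncomputable def cocyclicZeta (s : ℂ) : ℂ :=
  LSeries (fun k => (cocyclicCount k : ℂ)) s

/-- The `m`-th term `a_R^{cc}(p^m) / p^{ms}` of the local factor at `p`. -/
noncomputable def localTerm (p : ℕ) (s : ℂ) (m : ℕ) : ℂ :=
  (cocyclicCount (p ^ m) : ℂ) / ((p ^ m : ℕ) : ℂ) ^ s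

/-- The local factor `ζ_{R,p}^{cc}(s) = ∑_{m ≥ 0} a_R^{cc}(p^m) / p^{ms}`. -/
noncomputable def localCocyclicZeta (p : ℕ) (s : ℂ) : ℂ :=
  ∑' m : ℕ, localTerm p s m

/-- The factor `1 + 2 p^{-3/2} - p^{-5/2} - p^{-3} - p^{-7/2}`. -/
noncomputable def eulerFactor (p : ℕ) : ℝ :=
  1 + 2 * (p : ℝ) ^ (-(3 / 2) : ℝ) - (p : ℝ) ^ (-(5 / 2) : ℝ) - (p : ℝ) ^ (-3 : ℝ)
    - (p : ℝ) ^ (-(7 / 2) : ℝ)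

/-- The number of cocyclic subrings of `R` of index at most `B`. -/
noncomputable def cocyclicUpTo (B : ℝ) : ℕ :=
  ∑ k ∈ Finset.Icc 1 ⌊B⌋₊, cocyclicCount k

/-- The number of cocyclic subrings of `R` of odd index at most `B`. -/
noncomputable def oddCocyclicUpTo (B : ℝ) : ℕ :=
  ∑ k ∈ (Finset.Icc 1 ⌊B⌋₊).filter (fun k => Odd k), cocyclicCount k

/-!
A cocyclic subring `S` of index `k` in `R = ℤ[t]/(t⁴)` is the kernel of a surjection `R → ℤ/k`
killing `1`. The image of `t` is a unit (`isUnit_map_var`): modulo a prime dividing both it and `k`,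
the kernel would be a proper subring containing `t`. Normalizing `t ↦ 1`, `t² ↦ b`, `t³ ↦ c`,
closure of the kernel under multiplication becomes
`b³ = 2bc`, `b²c = c²`, `bc² = 0` in `ℤ/k`, and `cocyclicCount k` is the number of solutions
(`cocyclicCount_eq`). By the Chinese remainder theorem it is multiplicative.

Modulo `pⁿ`, sort the solutions by `β = v(b)`. For `β ≥ ⌊n/2⌋` the system reduces to `c² = 0`, which
gives `pⁿ` solutions altogether. For smaller `β` it reduces to `2c = b²` modulo `p ^ (n - β)` if
`n + 2 v(2) ≤ 4β`, and has no solution otherwise (`isRingPair_iff_of_lt`); every admissible `β` then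
contributes the same number of solutions. The resulting closed forms
(`cocyclicCount_odd_prime_pow`, `cocyclicCount_two_pow`) satisfy linear recurrences that sum the
local series.

Globally, the Dirichlet series is `ζ(2s - 2) H(s)`, where `ζ(2s - 2)` has the coefficients `n ↦ n`
on squares (`squareId`), and `H` is the series of `squareIdInv * f`. The local factors of `H` at odd
primes are `1 + O(p^{-σ} + p^{3 - 3σ})`, so `H` converges absolutely for `Re s > 4/3`
(`IsCocyclicLike.summable_quotient`). This gives the continuation with its simple pole at `3/2`.
It also gives the asymptotics without a Tauberian theorem: `∑_{n² ≤ y} n² ∼ y^{3/2} / 3`, and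
convolution with an absolutely convergent series multiplies this by `H(3/2)`
(`IsCocyclicLike.tendsto_sum_div`). The Euler product evaluates `H(3/2)` as `ζ(2)`
times the product of the Euler factors times a `2`-adic constant
(`IsCocyclicLike.quotient_three_halves`). The last two steps are done for any multiplicative
function with the right values at powers of odd primes, so that they apply to odd indices as well.
-/

/-! ### Coordinates on the truncated polynomial ring -/

/-- The coefficient of `tⁱ`, for `i < 4`, of an element of `ℤ[t]/(t⁴)`. -/
noncomputable def truncCoeff (i : Fin 4) : TruncRing →+ ℤ :=
  QuotientAddGroup.lift (Ideal.span {(X : ℤ[X]) ^ 4}).toAddSubgroup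
    (lcoeff ℤ (i : ℕ)).toAddMonoidHom (by
      intro p hp
      have hp' : (X : ℤ[X]) ^ 4 ∣ p := Ideal.mem_span_singleton.1 hp
      exact (X_pow_dvd_iff.1 hp') i i.2)

/-- The class `t` of the variable. -/
noncomputable def truncVar : TruncRing := Ideal.Quotient.mk _ X

lemma truncCoeff_mk (i : Fin 4) (p : ℤ[X]) :
    truncCoeff i (Ideal.Quotient.mk _ p) = p.coeff i := rfl

lemma truncVar_pow_four : truncVar ^ 4 = 0 := by
  rw [truncVar, ← map_pow]
  exact Ideal.Quotient.eq_zero_iff_mem.2 (Ideal.mem_span_singleton_self _)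

lemma truncCoeff_mul_one (r s : TruncRing) : truncCoeff 1 (r * s) =
    truncCoeff 0 r * truncCoeff 1 s + truncCoeff 1 r * truncCoeff 0 s := by
  obtain ⟨p, rfl⟩ := Ideal.Quotient.mk_surjective r
  obtain ⟨q, rfl⟩ := Ideal.Quotient.mk_surjective s
  simp only [← map_mul, truncCoeff_mk, coeff_mul]
  simp [Finset.Nat.antidiagonal_succ]

lemma truncCoeff_mul_two (r s : TruncRing) : truncCoeff 2 (r * s) =
    truncCoeff 0 r * truncCoeff 2 s + truncCoeff 1 r * truncCoeff 1 s
      + truncCoeff 2 r * truncCoeff 0 s := by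
  obtain ⟨p, rfl⟩ := Ideal.Quotient.mk_surjective r
  obtain ⟨q, rfl⟩ := Ideal.Quotient.mk_surjective s
  simp only [← map_mul, truncCoeff_mk, coeff_mul]
  simp [Finset.Nat.antidiagonal_succ, add_assoc]

lemma truncCoeff_mul_three (r s : TruncRing) : truncCoeff 3 (r * s) =
    truncCoeff 0 r * truncCoeff 3 s + truncCoeff 1 r * truncCoeff 2 s
      + truncCoeff 2 r * truncCoeff 1 s + truncCoeff 3 r * truncCoeff 0 s := by
  obtain ⟨p, rfl⟩ := Ideal.Quotient.mk_surjective r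
  obtain ⟨q, rfl⟩ := Ideal.Quotient.mk_surjective s
  simp only [← map_mul, truncCoeff_mk, coeff_mul]
  simp [Finset.Nat.antidiagonal_succ, add_assoc]

lemma truncCoeff_one (i : Fin 4) : truncCoeff i 1 = if i = 0 then 1 else 0 := by
  rw [← map_one (Ideal.Quotient.mk (Ideal.span {(X : ℤ[X]) ^ 4})), truncCoeff_mk, coeff_one]
  simp

lemma truncCoeff_var_pow (i : Fin 4) (j : ℕ) :
    truncCoeff i (truncVar ^ j) = if (i : ℕ) = j then 1 else 0 := by
  rw [truncVar, ← map_pow, truncCoeff_mk, coeff_X_pow]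

/-- `1, t, t², t³` generate `ℤ[t]/(t⁴)` as an abelian group. -/
lemma trunc_eq_sum (r : TruncRing) :
    r = truncCoeff 0 r • (1 : TruncRing) + truncCoeff 1 r • truncVar
      + truncCoeff 2 r • truncVar ^ 2 + truncCoeff 3 r • truncVar ^ 3 := by
  obtain ⟨p, rfl⟩ := Ideal.Quotient.mk_surjective r
  simp only [truncCoeff_mk, truncVar, ← map_one (Ideal.Quotient.mk (Ideal.span {(X : ℤ[X]) ^ 4})),
    ← map_pow, ← map_zsmul, ← map_add]
  rw [Ideal.Quotient.eq, Ideal.mem_span_singleton, X_pow_dvd_iff]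
  intro d hd
  interval_cases d <;> simp [coeff_X, coeff_one, -zsmul_eq_mul, -zsmul_one]

/-! ### Cocyclic subrings as solutions of a system of congruences -/

/-- The pairs `(b, c)` for which the kernel of the additive map `1 ↦ 0`, `t ↦ 1`, `t² ↦ b`,
`t³ ↦ c` from `ℤ[t]/(t⁴)` is closed under multiplication. -/
def ringPairs (A : Type*) [CommRing A] : Set (A × A) :=
  {x | x.1 ^ 3 = 2 * x.1 * x.2 ∧ x.1 ^ 2 * x.2 = x.2 ^ 2 ∧ x.1 * x.2 ^ 2 = 0}

/-- The additive map `1 ↦ 0`, `t ↦ 1`, `t² ↦ b`, `t³ ↦ c`. -/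
noncomputable def pairHom {k : ℕ} (x : ZMod k × ZMod k) : TruncRing →+ ZMod k :=
  (Int.castAddHom (ZMod k)).comp (truncCoeff 1)
    + ((AddMonoidHom.mulLeft x.1).comp ((Int.castAddHom (ZMod k)).comp (truncCoeff 2))
    + (AddMonoidHom.mulLeft x.2).comp ((Int.castAddHom (ZMod k)).comp (truncCoeff 3)))

lemma pairHom_apply {k : ℕ} (x : ZMod k × ZMod k) (r : TruncRing) :
    pairHom x r = (truncCoeff 1 r : ZMod k) + (x.1 * truncCoeff 2 r + x.2 * truncCoeff 3 r) := rfl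

/-- The kernel of `pairHom x`, as a subring. -/
noncomputable def pairSubring {k : ℕ} (x : ZMod k × ZMod k) (hx : x ∈ ringPairs (ZMod k)) :
    Subring TruncRing :=
  { (pairHom x).ker with
    one_mem' := by
      change pairHom x 1 = 0
      rw [pairHom_apply]
      simp [truncCoeff_one]
    mul_mem' := by
      intro r s hr hs
      change pairHom x r = 0 at hr
      change pairHom x s = 0 at hs
      change pairHom x (r * s) = 0
      obtain ⟨h1, h2, h3⟩ := hx
      rw [pairHom_apply] at *
      simp only [truncCoeff_mul_one, truncCoeff_mul_two, truncCoeff_mul_three, Int.cast_add,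
        Int.cast_mul]
      generalize (truncCoeff 0 r : ZMod k) = r0 at *
      generalize (truncCoeff 1 r : ZMod k) = r1 at *
      generalize (truncCoeff 2 r : ZMod k) = r2 at *
      generalize (truncCoeff 3 r : ZMod k) = r3 at *
      generalize (truncCoeff 0 s : ZMod k) = s0 at *
      generalize (truncCoeff 1 s : ZMod k) = s1 at *
      generalize (truncCoeff 2 s : ZMod k) = s2 at *
      generalize (truncCoeff 3 s : ZMod k) = s3 at *
      obtain rfl : r1 = -(x.1 * r2 + x.2 * r3) := by linear_combination hr
      obtain rfl : s1 = -(x.1 * s2 + x.2 * s3) := by linear_combination hs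
      linear_combination r2 * s2 * h1 + (r2 * s3 + r3 * s2) * h2 + r3 * s3 * h3 }

lemma mem_pairSubring {k : ℕ} {x : ZMod k × ZMod k} (hx : x ∈ ringPairs (ZMod k))
    (r : TruncRing) : r ∈ pairSubring x hx ↔ pairHom x r = 0 := Iff.rfl

lemma pairHom_var {k : ℕ} (x : ZMod k × ZMod k) : pairHom x truncVar = 1 := by
  have h := fun i => truncCoeff_var_pow i 1
  simp only [pow_one] at h
  simp [pairHom_apply, h]

lemma pairHom_var_sq {k : ℕ} (x : ZMod k × ZMod k) : pairHom x (truncVar ^ 2) = x.1 := by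
  rw [pairHom_apply]
  simp [truncCoeff_var_pow]

lemma pairHom_var_cube {k : ℕ} (x : ZMod k × ZMod k) : pairHom x (truncVar ^ 3) = x.2 := by
  rw [pairHom_apply]
  simp [truncCoeff_var_pow]

lemma pairHom_surjective {k : ℕ} (x : ZMod k × ZMod k) : Function.Surjective (pairHom x) := by
  intro y
  obtain ⟨n, rfl⟩ := ZMod.intCast_surjective y
  exact ⟨n • truncVar, by rw [map_zsmul, pairHom_var, zsmul_one]⟩

lemma pairSubring_mem {k : ℕ} (hk : k ≠ 0) {x : ZMod k × ZMod k} (hx : x ∈ ringPairs (ZMod k)) :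
    pairSubring x hx ∈ cocyclicSubrings k := by
  have : NeZero k := ⟨hk⟩
  have hker : (pairSubring x hx).toAddSubgroup = (pairHom x).ker := rfl
  let e := QuotientAddGroup.quotientKerEquivOfSurjective (pairHom x) (pairHom_surjective x)
  have hi : (pairHom x).ker.index = k := by
    rw [AddSubgroup.index, Nat.card_congr e.toEquiv, Nat.card_zmod]
  refine ⟨⟨?_, ?_⟩, ?_⟩
  · rw [hker]
    exact ⟨by rw [hi]; exact hk⟩
  · have : IsAddCyclic (TruncRing ⧸ (pairHom x).ker) :=
      isAddCyclic_of_surjective e.symm e.symm.surjective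
    exact this
  · rw [subringIndex, hker, hi]

lemma pairSubring_injective {k : ℕ} {x y : ZMod k × ZMod k} (hx : x ∈ ringPairs (ZMod k))
    (hy : y ∈ ringPairs (ZMod k)) (h : pairSubring x hx = pairSubring y hy) : x = y := by
  obtain ⟨b, hb⟩ := ZMod.intCast_surjective x.1
  obtain ⟨c, hc⟩ := ZMod.intCast_surjective x.2
  have h1 : truncVar ^ 2 - b • truncVar ∈ pairSubring x hx := by
    rw [mem_pairSubring, map_sub, map_zsmul, pairHom_var, pairHom_var_sq, zsmul_one, hb, sub_self]
  have h2 : truncVar ^ 3 - c • truncVar ∈ pairSubring x hx := by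
    rw [mem_pairSubring, map_sub, map_zsmul, pairHom_var, pairHom_var_cube, zsmul_one, hc, sub_self]
  rw [h, mem_pairSubring, map_sub, map_zsmul, pairHom_var, pairHom_var_sq, zsmul_one, hb,
    sub_eq_zero] at h1
  rw [h, mem_pairSubring, map_sub, map_zsmul, pairHom_var, pairHom_var_cube, zsmul_one, hc,
    sub_eq_zero] at h2
  exact Prod.ext h1.symm h2.symm

/-- If `ψ` is a surjection of `ℤ[t]/(t⁴)` onto `ℤ/k` whose kernel is a subring, then `ψ(t)` is a
unit. Otherwise, for some prime `p ∣ k`, the kernel of the reduction of `ψ` mod `p`, which is a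
subring too, would contain `t` and hence everything. -/
lemma isUnit_map_var {k : ℕ} (hk : k ≠ 0) (S : Subring TruncRing) (ψ : TruncRing →+ ZMod k)
    (hψ : Function.Surjective ψ) (hS : ∀ r, ψ r = 0 ↔ r ∈ S) : IsUnit (ψ truncVar) := by
  have : NeZero k := ⟨hk⟩
  by_contra hu
  have hnc : ¬ Nat.Coprime (ψ truncVar).val k := by
    rwa [← ZMod.isUnit_iff_coprime, ZMod.natCast_zmod_val]
  obtain ⟨p, hp, hpv, hpk⟩ := Nat.Prime.not_coprime_iff_dvd.1 hnc
  have hred : ∀ r, (p : ℤ) ∣ ((ψ r).val : ℤ) → ∃ s ∈ S, ∃ r', r = s + p • r' := by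
    rintro r hr
    obtain ⟨d, hd⟩ := Int.natCast_dvd_natCast.1 hr
    obtain ⟨r', hr'⟩ := hψ (d : ZMod k)
    refine ⟨r - p • r', (hS _).1 ?_, r', by abel⟩
    rw [map_sub, map_nsmul, hr', ← ZMod.natCast_zmod_val (ψ r), hd]
    simp
  let χ : TruncRing →+ ZMod p := (ZMod.castHom hpk (ZMod p)).toAddMonoidHom.comp ψ
  have hχ : ∀ r, χ r = (((ψ r).val : ℤ) : ZMod p) := by
    intro r
    change ZMod.castHom hpk (ZMod p) (ψ r) = _
    conv_lhs => rw [← ZMod.natCast_zmod_val (ψ r)]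
    rw [map_natCast, Int.cast_natCast]
  have hdec : ∀ r, χ r = 0 → ∃ s ∈ S, ∃ r', r = s + p • r' := fun r hr =>
    hred r ((ZMod.intCast_zmod_eq_zero_iff_dvd _ p).1 (by rw [← hχ, hr]))
  have hχS : ∀ s ∈ S, χ s = 0 := fun s hs => by
    change ZMod.castHom hpk (ZMod p) (ψ s) = 0
    rw [(hS s).2 hs, map_zero]
  have hχp : ∀ r, χ (p • r) = 0 := fun r => by rw [map_nsmul, nsmul_eq_mul]; simp
  have hmul : ∀ r s, χ r = 0 → χ s = 0 → χ (r * s) = 0 := by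
    intro r s hr hs
    obtain ⟨r1, hr1, r2, rfl⟩ := hdec r hr
    obtain ⟨s1, hs1, s2, rfl⟩ := hdec s hs
    have : (r1 + p • r2) * (s1 + p • s2) = r1 * s1 + p • (r1 * s2 + r2 * s1 + p • (r2 * s2)) := by
      simp only [nsmul_eq_mul]; ring
    rw [this, map_add, hχp, hχS _ (S.mul_mem hr1 hs1), add_zero]
  have ht : χ truncVar = 0 := by
    rw [hχ, ZMod.intCast_zmod_eq_zero_iff_dvd]
    exact_mod_cast hpv
  have ht2 : χ (truncVar ^ 2) = 0 := by
    rw [pow_two]; exact hmul _ _ ht ht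
  have ht3 : χ (truncVar ^ 3) = 0 := by
    rw [pow_succ truncVar 2]; exact hmul _ _ ht2 ht
  have hall : ∀ r, χ r = 0 := by
    intro r
    rw [trunc_eq_sum r]
    simp only [map_add, map_zsmul, ht, ht2, ht3, hχS 1 S.one_mem, smul_zero, add_zero]
  obtain ⟨r, hr⟩ := hψ 1
  have h1 : χ r = 1 := by
    change ZMod.castHom hpk (ZMod p) (ψ r) = 1
    rw [hr, map_one]
  have : Fact p.Prime := ⟨hp⟩
  exact one_ne_zero (h1.symm.trans (hall r))

lemma exists_pairSubring_eq {k : ℕ} (hk : k ≠ 0) {S : Subring TruncRing}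
    (hS : S ∈ cocyclicSubrings k) : ∃ x, ∃ hx : x ∈ ringPairs (ZMod k), S = pairSubring x hx := by
  have : NeZero k := ⟨hk⟩
  obtain ⟨⟨hfin, hcyc⟩, hidx⟩ := hS
  have hcard : Nat.card (TruncRing ⧸ S.toAddSubgroup) = k := hidx
  let e : ZMod k ≃+ TruncRing ⧸ S.toAddSubgroup :=
    (ZMod.ringEquivCongr hcard.symm).toAddEquiv.trans (zmodAddCyclicAddEquiv hcyc)
  let ψ : TruncRing →+ ZMod k :=
    e.symm.toAddMonoidHom.comp (QuotientAddGroup.mk' S.toAddSubgroup)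
  have hψs : Function.Surjective ψ :=
    e.symm.surjective.comp (QuotientAddGroup.mk'_surjective _)
  have hψ : ∀ r, ψ r = 0 ↔ r ∈ S := by
    intro r
    change e.symm (QuotientAddGroup.mk' S.toAddSubgroup r) = 0 ↔ _
    rw [map_eq_zero_iff _ e.symm.injective]
    exact QuotientAddGroup.eq_zero_iff r
  obtain ⟨u, hu⟩ := isUnit_map_var hk S ψ hψs hψ
  let φ : TruncRing →+ ZMod k := (AddMonoidHom.mulLeft (↑u⁻¹ : ZMod k)).comp ψ
  have hφ : ∀ r, φ r = 0 ↔ r ∈ S := fun r => by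
    rw [← hψ]
    exact Units.mul_right_eq_zero u⁻¹
  have hφt : φ truncVar = 1 := by
    change (↑u⁻¹ : ZMod k) * ψ truncVar = 1
    rw [← hu, Units.inv_mul]
  have hφ1 : φ 1 = 0 := (hφ 1).2 S.one_mem
  have hφx : ∀ r, φ r = pairHom (φ (truncVar ^ 2), φ (truncVar ^ 3)) r := by
    intro r
    conv_lhs => rw [trunc_eq_sum r]
    simp only [map_add, map_zsmul, hφ1, hφt, pairHom_apply, smul_zero, zero_add]
    simp only [zsmul_eq_mul, mul_one]
    ring
  obtain ⟨b, hb⟩ := ZMod.intCast_surjective (φ (truncVar ^ 2))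
  obtain ⟨c, hc⟩ := ZMod.intCast_surjective (φ (truncVar ^ 3))
  have hb' : truncVar ^ 2 - b • truncVar ∈ S := by
    rw [← hφ, map_sub, map_zsmul, hφt, zsmul_one, hb, sub_self]
  have hc' : truncVar ^ 3 - c • truncVar ∈ S := by
    rw [← hφ, map_sub, map_zsmul, hφt, zsmul_one, hc, sub_self]
  have ht4 := truncVar_pow_four
  have e1 : (truncVar ^ 2 - b • truncVar) * (truncVar ^ 2 - b • truncVar)
      = (b ^ 2) • truncVar ^ 2 - (2 * b) • truncVar ^ 3 := by
    simp only [zsmul_eq_mul]; push_cast; linear_combination ht4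
  have e2 : (truncVar ^ 2 - b • truncVar) * (truncVar ^ 3 - c • truncVar)
      = (b * c) • truncVar ^ 2 - c • truncVar ^ 3 := by
    simp only [zsmul_eq_mul]; push_cast; linear_combination (truncVar - b) * ht4
  have e3 : (truncVar ^ 3 - c • truncVar) * (truncVar ^ 3 - c • truncVar)
      = (c ^ 2) • truncVar ^ 2 := by
    simp only [zsmul_eq_mul]; push_cast; linear_combination (truncVar ^ 2 - 2 * c) * ht4
  have f1 := (hφ _).2 (S.mul_mem hb' hb')
  have f2 := (hφ _).2 (S.mul_mem hb' hc')
  have f3 := (hφ _).2 (S.mul_mem hc' hc')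
  rw [e1] at f1
  rw [e2] at f2
  rw [e3] at f3
  simp only [map_sub, map_zsmul, ← hb, ← hc] at f1 f2 f3
  simp only [zsmul_eq_mul] at f1 f2 f3
  push_cast at f1 f2 f3
  have hx : (φ (truncVar ^ 2), φ (truncVar ^ 3)) ∈ ringPairs (ZMod k) := by
    simp only [ringPairs, Set.mem_ofPred_eq, ← hb, ← hc]
    exact ⟨by linear_combination f1, by linear_combination f2, by linear_combination f3⟩
  refine ⟨_, hx, ?_⟩
  ext r
  rw [mem_pairSubring, ← hφx, hφ]

lemma cocyclicSubrings_eq_range {k : ℕ} (hk : k ≠ 0) :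
    cocyclicSubrings k = Set.range fun x : ringPairs (ZMod k) => pairSubring x.1 x.2 := by
  ext S
  constructor
  · intro hS
    obtain ⟨x, hx, rfl⟩ := exists_pairSubring_eq hk hS
    exact ⟨⟨x, hx⟩, rfl⟩
  · rintro ⟨x, rfl⟩
    exact pairSubring_mem hk x.2

lemma cocyclicSubrings_finite {k : ℕ} (hk : k ≠ 0) : (cocyclicSubrings k).Finite := by
  have : NeZero k := ⟨hk⟩
  rw [cocyclicSubrings_eq_range hk]
  exact Set.finite_range _

lemma cocyclicCount_eq {k : ℕ} (hk : k ≠ 0) :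
    cocyclicCount k = Nat.card (ringPairs (ZMod k)) := by
  rw [cocyclicCount, cocyclicSubrings_eq_range hk, ← Set.image_univ, Set.ncard_image_of_injective,
    Set.ncard_univ]
  intro x y h
  exact Subtype.ext (pairSubring_injective x.2 y.2 h)

lemma cocyclicCount_zero : cocyclicCount 0 = 0 := by
  have : cocyclicSubrings 0 = ∅ := by
    ext S
    simp only [Set.mem_empty_iff_false, iff_false]
    rintro ⟨⟨hf, -⟩, h⟩
    exact hf.index_ne_zero h
  rw [cocyclicCount, this, Set.ncard_empty]

/-! ### Multiplicativity -/

/-- A ring isomorphism `A ≃ B × C` identifies the solutions over `A` with pairs of solutions. -/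
def ringPairsProdEquiv {A B C : Type*} [CommRing A] [CommRing B] [CommRing C] (e : A ≃+* B × C) :
    ringPairs A ≃ ringPairs B × ringPairs C where
  toFun x := (⟨((e x.1.1).1, (e x.1.2).1), by
      obtain ⟨⟨b, c⟩, h1, h2, h3⟩ := x
      have h1 := congrArg (fun z => (e z).1) h1
      have h2 := congrArg (fun z => (e z).1) h2
      have h3 := congrArg (fun z => (e z).1) h3
      simp only [map_mul, map_pow, map_ofNat, map_zero] at h1 h2 h3
      exact ⟨h1, h2, h3⟩⟩,
    ⟨((e x.1.1).2, (e x.1.2).2), by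
      obtain ⟨⟨b, c⟩, h1, h2, h3⟩ := x
      have h1 := congrArg (fun z => (e z).2) h1
      have h2 := congrArg (fun z => (e z).2) h2
      have h3 := congrArg (fun z => (e z).2) h3
      simp only [map_mul, map_pow, map_ofNat, map_zero] at h1 h2 h3
      exact ⟨h1, h2, h3⟩⟩)
  invFun y := ⟨(e.symm (y.1.1.1, y.2.1.1), e.symm (y.1.1.2, y.2.1.2)), by
      obtain ⟨⟨⟨b, c⟩, h1, h2, h3⟩, ⟨⟨b', c'⟩, h1', h2', h3'⟩⟩ := y
      refine ⟨?_, ?_, ?_⟩ <;> apply e.injective <;>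
        simp only [map_mul, map_pow, map_ofNat, map_zero, RingEquiv.apply_symm_apply]
      · exact Prod.ext h1 h1'
      · exact Prod.ext h2 h2'
      · exact Prod.ext h3 h3'⟩
  left_inv x := by simp
  right_inv y := by simp

lemma cocyclicCount_mul {m n : ℕ} (h : Nat.Coprime m n) :
    cocyclicCount (m * n) = cocyclicCount m * cocyclicCount n := by
  rcases eq_or_ne m 0 with rfl | hm
  · simp [cocyclicCount_zero]
  rcases eq_or_ne n 0 with rfl | hn
  · simp [cocyclicCount_zero]
  rw [cocyclicCount_eq (mul_ne_zero hm hn), cocyclicCount_eq hm, cocyclicCount_eq hn,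
    Nat.card_congr (ringPairsProdEquiv (ZMod.chineseRemainder h)), Nat.card_prod]

lemma cocyclicCount_one : cocyclicCount 1 = 1 := by
  rw [cocyclicCount_eq one_ne_zero, Nat.card_eq_one_iff_unique]
  refine ⟨⟨fun x y => Subtype.ext (Subsingleton.elim _ _)⟩, ⟨⟨(0, 0), ?_⟩⟩⟩
  simp [ringPairs]

/-! ### Counting solutions modulo a prime power -/

/-- The equations defining `ringPairs (ZMod k)`, as divisibilities of integers. -/
def IsRingPair (k b c : ℤ) : Prop :=
  k ∣ b * (b ^ 2 - 2 * c) ∧ k ∣ c * (c - b ^ 2) ∧ k ∣ b * c ^ 2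

open Classical in
/-- The number of `c` modulo `k` that solve the system together with a given `b`. -/
noncomputable def fiberCount (k b : ℕ) : ℕ :=
  ((Finset.range k).filter fun c : ℕ => IsRingPair k b c).card

lemma isRingPair_iff (k b c : ℕ) :
    IsRingPair k b c ↔ ((b : ZMod k), (c : ZMod k)) ∈ ringPairs (ZMod k) := by
  simp only [IsRingPair, ← ZMod.intCast_zmod_eq_zero_iff_dvd, ringPairs, Set.mem_ofPred_eq]
  push_cast
  refine and_congr ⟨fun h => by linear_combination h, fun h => by linear_combination h⟩
    (and_congr ⟨fun h => by linear_combination -h, fun h => by linear_combination -h⟩ Iff.rfl)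

lemma card_ringPairs_eq_sum (k : ℕ) [NeZero k] :
    Nat.card (ringPairs (ZMod k)) = ∑ b ∈ Finset.range k, fiberCount k b := by
  classical
  let s : Finset (ℕ × ℕ) := (Finset.range k ×ˢ Finset.range k).filter
    fun x => IsRingPair k x.1 x.2
  have himg : ringPairs (ZMod k) = (fun x : ℕ × ℕ => ((x.1 : ZMod k), (x.2 : ZMod k))) '' s := by
    ext ⟨b, c⟩
    constructor
    · intro h
      refine ⟨(b.val, c.val), ?_, by simp⟩
      simp only [s, Finset.coe_filter, Finset.mem_product, Finset.mem_range, Set.mem_ofPred_eq]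
      refine ⟨⟨ZMod.val_lt b, ZMod.val_lt c⟩, ?_⟩
      rw [isRingPair_iff]
      simpa using h
    · rintro ⟨x, hx, h⟩
      simp only [s, Finset.coe_filter, Set.mem_ofPred_eq] at hx
      rw [← h]
      exact (isRingPair_iff _ _ _).1 hx.2
  have hinj : Set.InjOn (fun x : ℕ × ℕ => ((x.1 : ZMod k), (x.2 : ZMod k))) s := by
    rintro ⟨b, c⟩ hx ⟨b', c'⟩ hy h
    simp only [s, Finset.coe_filter, Finset.mem_product, Finset.mem_range,
      Set.mem_ofPred_eq] at hx hy
    simp only [Prod.mk.injEq, ZMod.natCast_eq_natCast_iff'] at h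
    rw [Nat.mod_eq_of_lt hx.1.1, Nat.mod_eq_of_lt hy.1.1, Nat.mod_eq_of_lt hx.1.2,
      Nat.mod_eq_of_lt hy.1.2] at h
    exact Prod.ext h.1 h.2
  rw [Nat.card_coe_set_eq, himg, hinj.ncard_image, Set.ncard_coe_finset]
  simp only [s, fiberCount, Finset.card_filter, Finset.sum_product]

lemma card_range_modEq (d m r : ℕ) (hd : 0 < d) :
    ((Finset.range (d * m)).filter fun c => c ≡ r [MOD d]).card = m := by
  have h := Nat.count_modEq_card (r := d) (d * m) hd r
  rw [Nat.count_eq_card_filter_range] at h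
  rw [h, Nat.mul_div_cancel_left _ hd, Nat.mul_mod_right]
  simp

lemma card_range_dvd (d m : ℕ) (hd : 0 < d) :
    ((Finset.range (d * m)).filter fun c => d ∣ c).card = m := by
  simpa only [Nat.modEq_zero_iff_dvd] using card_range_modEq d m 0 hd

lemma dvd_mul_iff_of_isCoprime {k m : ℤ} (h : IsCoprime k m) (x : ℤ) : k ∣ m * x ↔ k ∣ x :=
  ⟨h.dvd_of_dvd_mul_left, fun hx => hx.mul_left m⟩

lemma pow_dvd_pow_mul_iff_le {p : ℤ} (hp : Prime p) {u : ℤ} (hu : ¬ p ∣ u) (n a : ℕ) :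
    p ^ n ∣ p ^ a * u ↔ n ≤ a := by
  constructor
  · intro h
    by_contra! hlt
    obtain ⟨d, rfl⟩ := Nat.exists_eq_add_of_lt hlt
    rw [show a + d + 1 = a + (d + 1) by ring, pow_add] at h
    exact hu ((dvd_pow_self p (Nat.succ_ne_zero d)).trans
      ((mul_dvd_mul_iff_left (pow_ne_zero a hp.ne_zero)).1 h))
  · intro h
    exact (pow_dvd_pow p h).mul_right u

lemma pow_dvd_of_pow_dvd_sq {p : ℤ} (hp : Prime p) {n e : ℕ} {c : ℤ} (h : p ^ n ∣ c ^ 2)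
    (he : 2 * e ≤ n + 1) : p ^ e ∣ c := by
  induction e with
  | zero => simp
  | succ e ih =>
    obtain ⟨u, rfl⟩ := ih (by omega)
    rw [pow_succ]
    refine mul_dvd_mul_left _ ?_
    by_contra hu
    have hu2 : ¬ p ∣ u ^ 2 := fun h' => hu (hp.dvd_of_dvd_pow h')
    rw [mul_pow, ← pow_mul, pow_dvd_pow_mul_iff_le hp hu2] at h
    omega

/-- When `b` is divisible by `p ^ ⌊n/2⌋`, the system modulo `pⁿ` only says `c² = 0`. -/
lemma isRingPair_iff_of_pow_dvd {p : ℤ} (hp : Prime p) {n : ℕ} (hn : 2 ≤ n) {b c : ℤ}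
    (hb : p ^ (n / 2) ∣ b) : IsRingPair (p ^ n) b c ↔ p ^ (n - n / 2) ∣ c := by
  set q := n / 2 with hq
  have hb2 : p ^ (2 * q) ∣ b ^ 2 := by rw [mul_comm, pow_mul]; exact pow_dvd_pow_of_dvd hb 2
  constructor
  · rintro ⟨-, h2, -⟩
    have h3 : p ^ (2 * q) ∣ c ^ 2 := by
      have := dvd_add ((pow_dvd_pow p (show 2 * q ≤ n by omega)).trans h2) (hb2.mul_right c)
      rwa [show c * (c - b ^ 2) + b ^ 2 * c = c ^ 2 by ring] at this
    have h4 : p ^ q ∣ c := pow_dvd_of_pow_dvd_sq hp h3 (by omega)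
    have h5 : p ^ n ∣ b ^ 2 * c :=
      (pow_dvd_pow p (show n ≤ 2 * q + q by omega)).trans
        (by rw [pow_add]; exact mul_dvd_mul hb2 h4)
    have h6 := dvd_add h2 h5
    rw [show c * (c - b ^ 2) + b ^ 2 * c = c ^ 2 by ring] at h6
    exact pow_dvd_of_pow_dvd_sq hp h6 (by omega)
  · intro hc
    have hbc : p ^ n ∣ b * c :=
      (pow_dvd_pow p (show n ≤ q + (n - q) by omega)).trans
        (by rw [pow_add]; exact mul_dvd_mul hb hc)
    have hcc : p ^ n ∣ c ^ 2 :=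
      (pow_dvd_pow p (show n ≤ (n - q) * 2 by omega)).trans
        (by rw [pow_mul]; exact pow_dvd_pow_of_dvd hc 2)
    have hbbb : p ^ n ∣ b ^ 3 :=
      (pow_dvd_pow p (show n ≤ q * 3 by omega)).trans
        (by rw [pow_mul]; exact pow_dvd_pow_of_dvd hb 3)
    refine ⟨?_, ?_, ?_⟩
    · rw [show b * (b ^ 2 - 2 * c) = b ^ 3 - b * c * 2 by ring]
      exact dvd_sub hbbb (hbc.mul_right 2)
    · rw [show c * (c - b ^ 2) = c ^ 2 - b * c * b by ring]
      exact dvd_sub hcc (hbc.mul_right b)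
    · exact hcc.mul_left b

/-- The case of small `β = v(b)`. The first equation says `2c = b² - Y` with `p ^ (n - β) ∣ Y`, and
then `4c(c - b²) = Y² - b⁴`. Here `t = 2 v(2)` is what the factor `4` contributes. -/
lemma isRingPair_iff_of_lt {p : ℤ} (hp : Prime p) {n β t : ℕ} (hβ : 2 * β + 2 ≤ n) (ht : t ≤ 2)
    (h4 : ∀ x : ℤ, p ^ (n + t) ∣ 4 * x ↔ p ^ n ∣ x) {w c : ℤ} (hw : ¬ p ∣ w) :
    IsRingPair (p ^ n) (p ^ β * w) c ↔ n + t ≤ 4 * β ∧ p ^ (n - β) ∣ (p ^ β * w) ^ 2 - 2 * c := by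
  have key : p ^ n ∣ (p ^ β * w) * ((p ^ β * w) ^ 2 - 2 * c) ↔
      p ^ (n - β) ∣ (p ^ β * w) ^ 2 - 2 * c := by
    conv_lhs => rw [← Nat.add_sub_cancel' (show β ≤ n by omega), pow_add, mul_assoc]
    rw [mul_dvd_mul_iff_left (pow_ne_zero _ hp.ne_zero)]
    exact dvd_mul_iff_of_isCoprime (IsCoprime.pow_left ((hp.coprime_iff_not_dvd).2 hw)) _
  have hb4 : p ^ (n + t) ∣ (p ^ β * w) ^ 4 ↔ n + t ≤ 4 * β := by
    rw [mul_pow, ← pow_mul, mul_comm β 4]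
    exact pow_dvd_pow_mul_iff_le hp (fun h => hw (hp.dvd_of_dvd_pow h)) _ _
  have hb1 : p ^ β ∣ p ^ β * w := dvd_mul_right _ _
  rw [IsRingPair, key, and_comm (a := n + t ≤ 4 * β)]
  generalize p ^ β * w = b at *
  refine and_congr_right fun hY => ?_
  have hY2 : p ^ (n + t) ∣ (b ^ 2 - 2 * c) ^ 2 :=
    (pow_dvd_pow p (show n + t ≤ (n - β) * 2 by omega)).trans
      (by rw [pow_mul]; exact pow_dvd_pow_of_dvd hY 2)
  constructor
  · rintro ⟨h2, -⟩
    have := dvd_sub hY2 ((h4 _).2 h2)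
    rw [show (b ^ 2 - 2 * c) ^ 2 - 4 * (c * (c - b ^ 2)) = b ^ 4 by ring] at this
    exact hb4.1 this
  · intro hle
    have hb4' := hb4.2 hle
    refine ⟨(h4 _).1 ?_, (h4 _).1 ?_⟩
    · rw [show 4 * (c * (c - b ^ 2)) = (b ^ 2 - 2 * c) ^ 2 - b ^ 4 by ring]
      exact dvd_sub hY2 hb4'
    · have hb3Y : p ^ (n + t) ∣ b ^ 3 * (b ^ 2 - 2 * c) :=
        (pow_dvd_pow p (show n + t ≤ β * 3 + (n - β) by omega)).trans
          (by rw [pow_add, pow_mul]; exact mul_dvd_mul (pow_dvd_pow_of_dvd hb1 3) hY)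
      rw [show 4 * (b * c ^ 2) = b ^ 4 * b - b ^ 3 * (b ^ 2 - 2 * c) * 2
        + (b ^ 2 - 2 * c) ^ 2 * b by ring]
      exact dvd_add (dvd_sub (hb4'.mul_right b) (hb3Y.mul_right 2)) (hY2.mul_right b)

lemma fiberCount_of_pow_dvd {p : ℕ} (hp : p.Prime) {n : ℕ} (hn : 2 ≤ n) {b : ℕ}
    (hb : p ^ (n / 2) ∣ b) : fiberCount (p ^ n) b = p ^ (n / 2) := by
  classical
  rw [fiberCount, ← card_range_dvd (p ^ (n - n / 2)) (p ^ (n / 2)) (pow_pos hp.pos _), ← pow_add,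
    Nat.sub_add_cancel (Nat.div_le_self n 2)]
  congr 1
  refine Finset.filter_congr fun c _ => ?_
  have := isRingPair_iff_of_pow_dvd (Nat.prime_iff_prime_int.1 hp) hn (b := b) (c := c)
    (by exact_mod_cast hb)
  rw [Nat.cast_pow, this]
  exact_mod_cast Iff.rfl

lemma sum_range_dvd_split (p j k : ℕ) (f : ℕ → ℕ) :
    ∑ b ∈ (Finset.range k).filter (fun b => p ^ j ∣ b), f b
      = ∑ b ∈ (Finset.range k).filter (fun b => p ^ (j + 1) ∣ b), f b
        + ∑ b ∈ (Finset.range k).filter (fun b => p ^ j ∣ b ∧ ¬ p ^ (j + 1) ∣ b), f b := by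
  rw [← Finset.sum_filter_add_sum_filter_not ((Finset.range k).filter (fun b => p ^ j ∣ b))
    (fun b => p ^ (j + 1) ∣ b), Finset.filter_filter, Finset.filter_filter]
  congr 2
  refine Finset.filter_congr fun b _ => ?_
  exact ⟨fun h => h.2, fun h => ⟨(pow_dvd_pow p (Nat.le_succ j)).trans h, h⟩⟩

/-- The number of `b` modulo `pⁿ` of valuation exactly `β`. -/
lemma card_layer {p : ℕ} (hp : p.Prime) {n β : ℕ} (h : β + 1 ≤ n) :
    ((Finset.range (p ^ n)).filter (fun b => p ^ β ∣ b ∧ ¬ p ^ (β + 1) ∣ b)).card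
      = p ^ (n - β) - p ^ (n - β - 1) := by
  have h1 := sum_range_dvd_split p β (p ^ n) (fun _ => 1)
  simp only [← Finset.card_eq_sum_ones] at h1
  have h2 := card_range_dvd (p ^ β) (p ^ (n - β)) (pow_pos hp.pos _)
  have h3 := card_range_dvd (p ^ (β + 1)) (p ^ (n - β - 1)) (pow_pos hp.pos _)
  rw [← pow_add, show β + (n - β) = n by omega] at h2
  rw [← pow_add, show β + 1 + (n - β - 1) = n by omega] at h3
  omega

lemma sum_range_eq_sum_layers (p j k : ℕ) (f : ℕ → ℕ) :
    ∑ b ∈ Finset.range k, f b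
      = ∑ b ∈ (Finset.range k).filter (fun b => p ^ j ∣ b), f b
        + ∑ β ∈ Finset.range j,
          ∑ b ∈ (Finset.range k).filter (fun b => p ^ β ∣ b ∧ ¬ p ^ (β + 1) ∣ b), f b := by
  induction j with
  | zero => simp
  | succ j ih => rw [ih, sum_range_dvd_split, Finset.sum_range_succ]; ring

/-- The count modulo `pⁿ`, with `t = 2 v(2)`, when the fibre over each `b` of valuation `β` in the
admissible range `n + t ≤ 4β`, `2β + 2 ≤ n` consists of one class modulo `p ^ e β`. -/
lemma cocyclicCount_prime_pow_of_fibers {p : ℕ} (hp : p.Prime) {n t K : ℕ} (hn : 2 ≤ n) (ht : t ≤ 2)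
    (h4 : ∀ x : ℤ, (p : ℤ) ^ (n + t) ∣ 4 * x ↔ (p : ℤ) ^ n ∣ x) (e : ℕ → ℕ)
    (hK : ∀ β, 2 * β + 2 ≤ n → n + t ≤ 4 * β →
      e β ≤ n ∧ (p ^ (n - β) - p ^ (n - β - 1)) * p ^ (n - e β) = K)
    (hfib : ∀ β b : ℕ, 2 * β + 2 ≤ n → n + t ≤ 4 * β → p ^ β ∣ b →
      ∃ r : ℕ, ∀ c : ℕ, (p : ℤ) ^ (n - β) ∣ (b : ℤ) ^ 2 - 2 * c ↔ c ≡ r [MOD p ^ e β]) :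
    cocyclicCount (p ^ n) = p ^ n + (n / 2 - (n + t + 3) / 4) * K := by
  classical
  have hpk : p ^ n ≠ 0 := pow_ne_zero n hp.ne_zero
  have : NeZero (p ^ n) := ⟨hpk⟩
  have hpp := Nat.prime_iff_prime_int.1 hp
  rw [cocyclicCount_eq hpk, card_ringPairs_eq_sum, sum_range_eq_sum_layers p (n / 2)]
  congr 1
  · rw [Finset.sum_congr rfl fun b hb => fiberCount_of_pow_dvd hp hn (Finset.mem_filter.1 hb).2,
      Finset.sum_const]
    have h2 := card_range_dvd (p ^ (n / 2)) (p ^ (n - n / 2)) (pow_pos hp.pos _)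
    rw [← pow_add, show n / 2 + (n - n / 2) = n by omega] at h2
    rw [h2, smul_eq_mul, ← pow_add, Nat.sub_add_cancel (Nat.div_le_self n 2)]
  · have hlayer : ∀ β ∈ Finset.range (n / 2),
        ∑ b ∈ (Finset.range (p ^ n)).filter (fun b => p ^ β ∣ b ∧ ¬ p ^ (β + 1) ∣ b),
          fiberCount (p ^ n) b = if n + t ≤ 4 * β then K else 0 := by
      intro β hβ
      have hβ2 : 2 * β + 2 ≤ n := by have := Finset.mem_range.1 hβ; omega
      have hiff : ∀ b ∈ (Finset.range (p ^ n)).filter (fun b => p ^ β ∣ b ∧ ¬ p ^ (β + 1) ∣ b),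
          ∀ c : ℕ, IsRingPair ((p ^ n : ℕ) : ℤ) b c ↔
            n + t ≤ 4 * β ∧ (p : ℤ) ^ (n - β) ∣ (b : ℤ) ^ 2 - 2 * c := by
        intro b hb c
        obtain ⟨-, ⟨w, rfl⟩, hnd⟩ := Finset.mem_filter.1 hb
        have hw : ¬ (p : ℤ) ∣ (w : ℤ) := fun h => hnd (by
          rw [pow_succ]; exact mul_dvd_mul_left _ (Int.natCast_dvd_natCast.1 h))
        have := isRingPair_iff_of_lt hpp hβ2 ht h4 (c := c) hw
        push_cast
        exact this
      split_ifs with hle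
      · obtain ⟨hen, hKβ⟩ := hK β hβ2 hle
        have hone : ∀ b ∈ (Finset.range (p ^ n)).filter
            (fun b => p ^ β ∣ b ∧ ¬ p ^ (β + 1) ∣ b), fiberCount (p ^ n) b = p ^ (n - e β) := by
          intro b hb
          obtain ⟨r, hr⟩ := hfib β b hβ2 hle (Finset.mem_filter.1 hb).2.1
          rw [fiberCount, ← card_range_modEq (p ^ e β) (p ^ (n - e β)) r (pow_pos hp.pos _),
            ← pow_add, show e β + (n - e β) = n by omega]
          congr 1
          refine Finset.filter_congr fun c _ => ?_
          rw [hiff b hb c, hr c]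
          exact and_iff_right hle
        rw [Finset.sum_congr rfl hone, Finset.sum_const, card_layer hp (by omega), smul_eq_mul, hKβ]
      · refine Finset.sum_eq_zero fun b hb => ?_
        rw [fiberCount, Finset.card_eq_zero, Finset.filter_eq_empty_iff]
        intro c _ h
        exact hle ((hiff b hb c).1 h).1
    rw [Finset.sum_congr rfl hlayer, ← Finset.sum_filter, Finset.sum_const, smul_eq_mul]
    congr 1
    have : (Finset.range (n / 2)).filter (fun β => n + t ≤ 4 * β)
        = Finset.Ico ((n + t + 3) / 4) (n / 2) := by
      ext β
      simp only [Finset.mem_filter, Finset.mem_range, Finset.mem_Ico]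
      omega
    rw [this, Nat.card_Ico]

lemma cocyclicCount_odd_prime_pow {p : ℕ} (hp : p.Prime) (hp2 : p ≠ 2) {n : ℕ} (hn : 2 ≤ n) :
    cocyclicCount (p ^ n) = p ^ n + (n / 2 - (n + 3) / 4) * (p ^ n - p ^ (n - 1)) := by
  have hpp := Nat.prime_iff_prime_int.1 hp
  have hodd : Odd p := hp.odd_of_ne_two hp2
  have hcop2 : ∀ m : ℕ, IsCoprime ((p : ℤ) ^ m) 2 := fun m => by
    have h : Nat.Coprime (p ^ m) 2 := (Nat.coprime_two_right.2 hodd).pow_left m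
    exact_mod_cast Nat.isCoprime_iff_coprime.2 h
  refine cocyclicCount_prime_pow_of_fibers hp (t := 0) hn (by omega) ?_ (fun β => n - β) ?_ ?_
  · intro x
    rw [show (4 : ℤ) * x = 2 * (2 * x) by ring, add_zero]
    rw [dvd_mul_iff_of_isCoprime (hcop2 n), dvd_mul_iff_of_isCoprime (hcop2 n)]
  · intro β hβ _
    refine ⟨Nat.sub_le n β, ?_⟩
    rw [Nat.sub_mul, ← pow_add, ← pow_add]
    congr 2 <;> omega
  · intro β b hβ _ _
    -- `(p ^ (n - β) + 1) / 2` is an inverse of `2` modulo `p ^ (n - β)`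
    obtain ⟨h, hh⟩ : ∃ h, p ^ (n - β) + 1 = 2 * h := (hodd.pow.add_one).two_dvd
    refine ⟨b ^ 2 * h, fun c => ?_⟩
    rw [Nat.modEq_iff_dvd, Nat.cast_pow, 
      ← dvd_mul_iff_of_isCoprime (hcop2 (n - β)) (((b ^ 2 * h : ℕ) : ℤ) - c)]
    push_cast
    have hh' : (p : ℤ) ^ (n - β) + 1 = 2 * h := by exact_mod_cast hh
    rw [show (2 : ℤ) * ((b : ℤ) ^ 2 * h - c) = ((b : ℤ) ^ 2 - 2 * c) + p ^ (n - β) * b ^ 2 by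
      linear_combination -(b : ℤ) ^ 2 * hh']
    exact (dvd_add_left (dvd_mul_right _ _)).symm

lemma cocyclicCount_two_pow {n : ℕ} (hn : 2 ≤ n) :
    cocyclicCount (2 ^ n) = 2 ^ n + (n / 2 - (n + 5) / 4) * 2 ^ n := by
  refine cocyclicCount_prime_pow_of_fibers Nat.prime_two (t := 2) hn le_rfl ?_ (fun β => n - β - 1) ?_ ?_
  · intro x
    rw [pow_add, mul_comm]
    exact mul_dvd_mul_iff_left (by norm_num : (4 : ℤ) ≠ 0)
  · intro β hβ _
    refine ⟨by omega, ?_⟩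
    rw [show n - β = n - β - 1 + 1 by omega, pow_succ, Nat.add_sub_cancel,
      show 2 ^ (n - β - 1) * 2 - 2 ^ (n - β - 1) = 2 ^ (n - β - 1) by omega, ← pow_add]
    congr 1
    omega
  · intro β b hβ hle hb
    obtain ⟨w, hw⟩ : 2 ∣ b := (dvd_pow_self 2 (by omega)).trans hb
    refine ⟨2 * w ^ 2, fun c => ?_⟩
    rw [Nat.modEq_iff_dvd, hw]
    push_cast
    rw [show n - β = n - β - 1 + 1 by omega, pow_succ, Nat.add_sub_cancel,
      show (2 * (w : ℤ)) ^ 2 - 2 * c = (2 * w ^ 2 - c) * 2 by ring]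
    exact mul_dvd_mul_iff_right two_ne_zero

/-- Modulo a prime the only solution is `b = c = 0`. -/
lemma cocyclicCount_prime {p : ℕ} (hp : p.Prime) : cocyclicCount p = 1 := by
  have : Fact p.Prime := ⟨hp⟩
  rw [cocyclicCount_eq hp.ne_zero, Nat.card_eq_one_iff_unique]
  refine ⟨⟨?_⟩, ⟨⟨(0, 0), by simp [ringPairs]⟩⟩⟩
  suffices h : ∀ x : ringPairs (ZMod p), x.1 = (0, 0) from
    fun x y => Subtype.ext ((h x).trans (h y).symm)
  rintro ⟨⟨b, c⟩, h1, h2, h3⟩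
  simp only at h1 h2 h3
  rcases mul_eq_zero.1 h3 with rfl | hc
  · have : c ^ 2 = 0 := by rw [← h2]; ring
    simp [pow_eq_zero_iff] at this
    simp [this]
  · have hc0 : c = 0 := by simpa using hc
    subst hc0
    have : b ^ 3 = 0 := by rw [h1]; ring
    simp [pow_eq_zero_iff] at this
    simp [this]

/-! ### The local series -/

/-- For odd `p` and exponent `n ≥ 1`, with the integer `⌊n/2⌋ - ⌈n/4⌉` (which is `-1` at
`n = 1`). -/
lemma cocyclicCount_odd_prime_pow_succ {p : ℕ} (hp : p.Prime) (hp2 : p ≠ 2) (j : ℕ) :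
    (cocyclicCount (p ^ (j + 1)) : ℂ)
      = p ^ j * (p + ((((j + 1) / 2 : ℕ) : ℤ) - (((j + 4) / 4 : ℕ) : ℤ) : ℤ) * (p - 1)) := by
  rcases Nat.eq_zero_or_pos j with rfl | hj
  · rw [zero_add, pow_one, cocyclicCount_prime hp]
    norm_num
  · rw [cocyclicCount_odd_prime_pow hp hp2 (by omega : 2 ≤ j + 1), Nat.add_sub_cancel,
      show j + 1 + 3 = j + 4 by ring]
    have hle : (j + 4) / 4 ≤ (j + 1) / 2 := by omega
    generalize (j + 4) / 4 = u, (j + 1) / 2 = v at *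
    push_cast
    rw [Nat.cast_sub hle, Nat.cast_sub (Nat.pow_le_pow_right hp.pos (Nat.le_add_right j 1))]
    push_cast
    ring

lemma cocyclicCount_odd_prime_pow_rec {p : ℕ} (hp : p.Prime) (hp2 : p ≠ 2) (n : ℕ) :
    (cocyclicCount (p ^ (n + 6)) : ℂ) = p ^ 2 * cocyclicCount (p ^ (n + 4))
      + p ^ 4 * cocyclicCount (p ^ (n + 2)) - p ^ 6 * cocyclicCount (p ^ n) := by
  have hs := cocyclicCount_odd_prime_pow_succ hp hp2
  rcases n with _ | j
  · rw [hs 5, hs 3, hs 1, pow_zero, cocyclicCount_one]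
    norm_num
    ring
  · rw [show j + 1 + 6 = (j + 6) + 1 by ring, show j + 1 + 4 = (j + 4) + 1 by ring,
      show j + 1 + 2 = (j + 2) + 1 by ring, hs, hs, hs, hs]
    have hE : (((j + 6 + 1) / 2 : ℕ) : ℤ) - (((j + 6 + 4) / 4 : ℕ) : ℤ)
        = ((((j + 4 + 1) / 2 : ℕ) : ℤ) - (((j + 4 + 4) / 4 : ℕ) : ℤ))
        + ((((j + 2 + 1) / 2 : ℕ) : ℤ) - (((j + 2 + 4) / 4 : ℕ) : ℤ))
        - ((((j + 1) / 2 : ℕ) : ℤ) - (((j + 4) / 4 : ℕ) : ℤ)) := by omega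
    rw [hE]
    push_cast
    ring

lemma cocyclicCount_two_pow_rec (n : ℕ) :
    (cocyclicCount (2 ^ (n + 11)) : ℂ) = 8 * cocyclicCount (2 ^ (n + 8))
      + 16 * cocyclicCount (2 ^ (n + 7)) - 128 * cocyclicCount (2 ^ (n + 4)) := by
  have hE : (n + 11) / 2 - (n + 11 + 5) / 4 + ((n + 4) / 2 - (n + 4 + 5) / 4)
      = ((n + 8) / 2 - (n + 8 + 5) / 4) + ((n + 7) / 2 - (n + 7 + 5) / 4) := by omega
  have hE' : (((n + 11) / 2 - (n + 11 + 5) / 4 : ℕ) : ℂ)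
      = (((n + 8) / 2 - (n + 8 + 5) / 4 : ℕ) : ℂ) + (((n + 7) / 2 - (n + 7 + 5) / 4 : ℕ) : ℂ)
        - (((n + 4) / 2 - (n + 4 + 5) / 4 : ℕ) : ℂ) := by
    rw [eq_sub_iff_add_eq]
    exact_mod_cast hE
  rw [cocyclicCount_two_pow (by omega), cocyclicCount_two_pow (by omega),
    cocyclicCount_two_pow (by omega), cocyclicCount_two_pow (by omega)]
  simp only [Nat.cast_add, Nat.cast_mul, Nat.cast_pow, Nat.cast_ofNat] at hE' ⊢
  rw [hE']
  ring

lemma cocyclicCount_prime_pow_le {p : ℕ} (hp : p.Prime) (n : ℕ) :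
    cocyclicCount (p ^ n) ≤ (n + 1) * p ^ n := by
  rcases n with _ | _ | n
  · simp [cocyclicCount_one]
  · rw [zero_add, pow_one, cocyclicCount_prime hp]
    nlinarith [hp.pos]
  · have hbound : ∀ a K : ℕ, a ≤ (n + 2) → K ≤ p ^ (n + 2) →
        p ^ (n + 2) + a * K ≤ (n + 2 + 1) * p ^ (n + 2) := by
      intro a K ha hK
      have := Nat.mul_le_mul ha hK
      linarith
    rcases eq_or_ne p 2 with rfl | hp2
    · rw [cocyclicCount_two_pow (by omega)]
      exact hbound _ _ (by omega) le_rfl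
    · rw [cocyclicCount_odd_prime_pow hp hp2 (by omega)]
      exact hbound _ _ (by omega) (Nat.sub_le _ _)

lemma summable_norm_local {p : ℕ} (hp : p.Prime) {x : ℂ} (hx : ‖(p : ℂ) * x‖ < 1) :
    Summable fun n => ‖(cocyclicCount (p ^ n) : ℂ) * x ^ n‖ := by
  have h1 := (summable_pow_mul_geometric_of_norm_lt_one 1 (r := ‖(p : ℂ) * x‖) (by simpa using hx))
  have h2 := summable_geometric_of_lt_one (norm_nonneg _) hx
  refine Summable.of_nonneg_of_le (fun _ => norm_nonneg _) (fun n => ?_) (h1.add h2)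
  have := cocyclicCount_prime_pow_le hp n
  have hc : (cocyclicCount (p ^ n) : ℝ) ≤ (n + 1) * (p : ℝ) ^ n := by exact_mod_cast this
  rw [norm_mul, norm_pow, norm_mul, Complex.norm_natCast, Complex.norm_natCast, pow_one, mul_pow]
  calc (cocyclicCount (p ^ n) : ℝ) * ‖x‖ ^ n ≤ ((n + 1) * (p : ℝ) ^ n) * ‖x‖ ^ n := by gcongr
    _ = _ := by ring

lemma one_sub_pow_ne_zero {u : ℂ} (hu : ‖u‖ < 1) {k : ℕ} (hk : k ≠ 0) : 1 - u ^ k ≠ 0 := by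
  intro h
  have h1 : ‖u ^ k‖ < 1 := by
    rw [norm_pow]
    exact pow_lt_one₀ (norm_nonneg _) hu hk
  rw [← sub_eq_zero.1 h, norm_one] at h1
  exact lt_irrefl _ h1

lemma local_odd_mul {p : ℕ} (hp : p.Prime) (hp2 : p ≠ 2) {x : ℂ} (hx : ‖(p : ℂ) * x‖ < 1) :
    (∑' n, (cocyclicCount (p ^ n) : ℂ) * x ^ n) * ((1 - p ^ 2 * x ^ 2) * (1 - p ^ 4 * x ^ 4))
      = 1 + x + ((p : ℂ) ^ 3 - p ^ 2) * x ^ 3 - p ^ 3 * x ^ 4 - p ^ 4 * x ^ 5 := by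
  have hsum := (summable_norm_local hp hx).of_norm
  have hs := cocyclicCount_odd_prime_pow_succ hp hp2
  set f : ℕ → ℂ := fun n => (cocyclicCount (p ^ n) : ℂ) * x ^ n with hf
  have hrec : ∀ n, f (n + 6) = p ^ 2 * x ^ 2 * f (n + 4) + p ^ 4 * x ^ 4 * f (n + 2)
      - p ^ 6 * x ^ 6 * f n := by
    intro n
    simp only [hf]
    rw [cocyclicCount_odd_prime_pow_rec hp hp2]
    ring
  have h2 := hsum.sum_add_tsum_nat_add 2
  have h4 := hsum.sum_add_tsum_nat_add 4
  have h6 := hsum.sum_add_tsum_nat_add 6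
  have s2 := (summable_nat_add_iff 2).2 hsum
  have s4 := (summable_nat_add_iff 4).2 hsum
  have htail : ∑' n, f (n + 6) = p ^ 2 * x ^ 2 * ∑' n, f (n + 4)
      + p ^ 4 * x ^ 4 * ∑' n, f (n + 2) - p ^ 6 * x ^ 6 * ∑' n, f n := by
    simp only [hrec]
    rw [((s4.mul_left _).add (s2.mul_left _)).tsum_sub (hsum.mul_left _),
      (s4.mul_left _).tsum_add (s2.mul_left _), tsum_mul_left, tsum_mul_left, tsum_mul_left]
  have f0 : f 0 = 1 := by simp [hf, cocyclicCount_one]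
  have f1 : f 1 = x := by simp [hf, cocyclicCount_prime hp]
  have a2 : (cocyclicCount (p ^ 2) : ℂ) = p ^ 2 := by
    rw [hs 1]; norm_num; ring
  have f2 : f 2 = p ^ 2 * x ^ 2 := by rw [hf, ← a2]
  have a3 : (cocyclicCount (p ^ 3) : ℂ) = p ^ 3 := by
    rw [hs 2]; norm_num; ring
  have f3 : f 3 = p ^ 3 * x ^ 3 := by rw [hf, ← a3]
  have a4 : (cocyclicCount (p ^ 4) : ℂ) = p ^ 3 * (2 * p - 1) := by
    rw [hs 3]; norm_num [two_mul]; left; ring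
  have f4 : f 4 = p ^ 3 * (2 * p - 1) * x ^ 4 := by rw [hf, ← a4]
  have a5 : (cocyclicCount (p ^ 5) : ℂ) = p ^ 5 := by
    rw [hs 4]; norm_num; ring
  have f5 : f 5 = p ^ 5 * x ^ 5 := by rw [hf, ← a5]
  simp only [Finset.sum_range_succ, Finset.sum_range_zero, f0, f1, f2, f3, f4, f5] at h2 h4 h6
  linear_combination (-1 : ℂ) * h6 + htail + (p : ℂ) ^ 2 * x ^ 2 * h4 + (p : ℂ) ^ 4 * x ^ 4 * h2

lemma local_two_mul {x : ℂ} (hx : ‖((2 : ℕ) : ℂ) * x‖ < 1) :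
    (∑' n, (cocyclicCount (2 ^ n) : ℂ) * x ^ n) * ((1 - 2 ^ 4 * x ^ 4) * (1 - 2 ^ 3 * x ^ 3))
      = 1 + x + 2 ^ 2 * x ^ 2 - 2 ^ 3 * x ^ 4 - 2 ^ 4 * x ^ 5 + 2 ^ 7 * x ^ 8
        + 2 ^ 10 * x ^ 10 := by
  have hsum := (summable_norm_local Nat.prime_two hx).of_norm
  set f : ℕ → ℂ := fun n => (cocyclicCount (2 ^ n) : ℂ) * x ^ n with hf
  have hrec : ∀ n, f (n + 11) = 8 * x ^ 3 * f (n + 8) + 16 * x ^ 4 * f (n + 7)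
      - 128 * x ^ 7 * f (n + 4) := by
    intro n
    simp only [hf]
    rw [cocyclicCount_two_pow_rec]
    ring
  have h4 := hsum.sum_add_tsum_nat_add 4
  have h7 := hsum.sum_add_tsum_nat_add 7
  have h8 := hsum.sum_add_tsum_nat_add 8
  have h11 := hsum.sum_add_tsum_nat_add 11
  have s4 := (summable_nat_add_iff 4).2 hsum
  have s7 := (summable_nat_add_iff 7).2 hsum
  have s8 := (summable_nat_add_iff 8).2 hsum
  have htail : ∑' n, f (n + 11) = 8 * x ^ 3 * ∑' n, f (n + 8)
      + 16 * x ^ 4 * ∑' n, f (n + 7) - 128 * x ^ 7 * ∑' n, f (n + 4) := by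
    simp only [hrec]
    rw [((s8.mul_left _).add (s7.mul_left _)).tsum_sub (s4.mul_left _),
      (s8.mul_left _).tsum_add (s7.mul_left _), tsum_mul_left, tsum_mul_left, tsum_mul_left]
  have f0 : f 0 = 1 := by simp [hf, cocyclicCount_one]
  have f1 : f 1 = x := by simp [hf, cocyclicCount_prime Nat.prime_two]
  have fs : ∀ n, 2 ≤ n → f n = ((2 ^ n + (n / 2 - (n + 5) / 4) * 2 ^ n : ℕ) : ℂ) * x ^ n :=
    fun n hn => by simp only [hf]; rw [cocyclicCount_two_pow hn]
  have f2 : f 2 = 4 * x ^ 2 := by rw [fs 2 (by norm_num)]; norm_num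
  have f3 : f 3 = 8 * x ^ 3 := by rw [fs 3 (by norm_num)]; norm_num
  have f4 : f 4 = 16 * x ^ 4 := by rw [fs 4 (by norm_num)]; norm_num
  have f5 : f 5 = 32 * x ^ 5 := by rw [fs 5 (by norm_num)]; norm_num
  have f6 : f 6 = 128 * x ^ 6 := by rw [fs 6 (by norm_num)]; norm_num
  have f7 : f 7 = 128 * x ^ 7 := by rw [fs 7 (by norm_num)]; norm_num
  have f8 : f 8 = 512 * x ^ 8 := by rw [fs 8 (by norm_num)]; norm_num
  have f9 : f 9 = 1024 * x ^ 9 := by rw [fs 9 (by norm_num)]; norm_num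
  have f10 : f 10 = 3072 * x ^ 10 := by rw [fs 10 (by norm_num)]; norm_num
  simp only [Finset.sum_range_succ, Finset.sum_range_zero, f0, f1, f2, f3, f4, f5, f6, f7, f8, f9,
    f10] at h4 h7 h8 h11
  linear_combination (-1 : ℂ) * h11 + htail + 8 * x ^ 3 * h8 + 16 * x ^ 4 * h7 - 128 * x ^ 7 * h4

lemma natCast_pow_cpow (p m : ℕ) (s : ℂ) : ((p ^ m : ℕ) : ℂ) ^ s = ((p : ℂ) ^ s) ^ m := by
  induction m with
  | zero => simp
  | succ m ih => rw [pow_succ, Nat.cast_mul, Complex.natCast_mul_natCast_cpow, ih, pow_succ]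

lemma localTerm_eq (p : ℕ) (s : ℂ) (m : ℕ) :
    localTerm p s m = (cocyclicCount (p ^ m) : ℂ) * ((p : ℂ) ^ (-s)) ^ m := by
  rw [localTerm, natCast_pow_cpow, Complex.cpow_neg, inv_pow, div_eq_mul_inv]

lemma norm_prime_mul_cpow_lt_one {p : ℕ} (hp : p.Prime) {s : ℂ} (hs : 1 < s.re) :
    ‖(p : ℂ) * (p : ℂ) ^ (-s)‖ < 1 := by
  have h0 : (0 : ℝ) < p := by exact_mod_cast hp.pos
  rw [norm_mul, Complex.norm_natCast, Complex.norm_natCast_cpow_of_pos hp.pos, Complex.neg_re]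
  nth_rw 1 [← Real.rpow_one (p : ℝ)]
  rw [← Real.rpow_add h0]
  exact Real.rpow_lt_one_of_one_lt_of_neg (by exact_mod_cast hp.one_lt) (by linarith)

lemma summable_localTerm {p : ℕ} (hp : p.Prime) {s : ℂ} (hs : 1 < s.re) :
    Summable (localTerm p s) := by
  rw [funext (localTerm_eq p s)]
  exact (summable_norm_local hp (norm_prime_mul_cpow_lt_one hp hs)).of_norm

lemma localCocyclicZeta_odd_mul {p : ℕ} (hp : p.Prime) (hp2 : p ≠ 2) {s : ℂ} (hs : 1 < s.re)
    {x : ℂ} (hx : x = (p : ℂ) ^ (-s)) :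
    localCocyclicZeta p s * ((1 - p ^ 2 * x ^ 2) * (1 - p ^ 4 * x ^ 4))
      = 1 + x + ((p : ℂ) ^ 3 - p ^ 2) * x ^ 3 - p ^ 3 * x ^ 4 - p ^ 4 * x ^ 5 := by
  have hlt := norm_prime_mul_cpow_lt_one hp hs
  simp only [localCocyclicZeta, localTerm_eq, ← hx] at *
  exact local_odd_mul hp hp2 hlt

lemma localCocyclicZeta_two_mul {s : ℂ} (hs : 1 < s.re) {x : ℂ} (hx : x = (2 : ℂ) ^ (-s)) :
    localCocyclicZeta 2 s * ((1 - 2 ^ 4 * x ^ 4) * (1 - 2 ^ 3 * x ^ 3))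
      = 1 + x + 2 ^ 2 * x ^ 2 - 2 ^ 3 * x ^ 4 - 2 ^ 4 * x ^ 5 + 2 ^ 7 * x ^ 8
        + 2 ^ 10 * x ^ 10 := by
  have hlt := norm_prime_mul_cpow_lt_one Nat.prime_two hs
  simp only [localCocyclicZeta, localTerm_eq, Nat.cast_ofNat, ← hx] at *
  exact local_two_mul (by simpa using hlt)

lemma local_odd_denom_ne_zero {p : ℕ} (hp : p.Prime) {s : ℂ} (hs : 1 < s.re) {x : ℂ}
    (hx : x = (p : ℂ) ^ (-s)) : (1 - (p : ℂ) ^ 2 * x ^ 2) * (1 - (p : ℂ) ^ 4 * x ^ 4) ≠ 0 := by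
  have hlt := norm_prime_mul_cpow_lt_one hp hs
  rw [← hx] at hlt
  rw [← mul_pow, ← mul_pow]
  exact mul_ne_zero (one_sub_pow_ne_zero hlt two_ne_zero) (one_sub_pow_ne_zero hlt four_ne_zero)

lemma local_two_denom_ne_zero {s : ℂ} (hs : 1 < s.re) {x : ℂ} (hx : x = (2 : ℂ) ^ (-s)) :
    (1 - (2 : ℂ) ^ 4 * x ^ 4) * (1 - (2 : ℂ) ^ 3 * x ^ 3) ≠ 0 := by
  have hlt := norm_prime_mul_cpow_lt_one Nat.prime_two hs
  rw [Nat.cast_ofNat, ← hx] at hlt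
  rw [← mul_pow, ← mul_pow]
  exact mul_ne_zero (one_sub_pow_ne_zero hlt four_ne_zero) (one_sub_pow_ne_zero hlt three_ne_zero)

lemma localCocyclicZeta_two_three_halves :
    localCocyclicZeta 2 (3 / 2) = ((7 / 3 + 5 / 6 * √2 : ℝ) : ℂ) := by
  have hs : 1 < ((3 : ℂ) / 2).re := by norm_num
  have hy : ((√2 : ℝ) : ℂ) ^ 2 = 2 := by
    rw [← Complex.ofReal_pow, Real.sq_sqrt (by norm_num)]; norm_num
  have hx : ((√2 : ℝ) : ℂ) / 4 = (2 : ℂ) ^ (-(3 / 2 : ℂ)) := by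
    have h : (2 : ℝ) ^ (-(3 / 2) : ℝ) = √2 / 4 := by
      rw [show (-(3 / 2) : ℝ) = 1 / 2 + (-2 : ℤ) by norm_num, Real.rpow_add (by norm_num),
        Real.rpow_intCast, ← Real.sqrt_eq_rpow]
      norm_num
      ring
    have h2 := congrArg (fun z : ℝ => (z : ℂ)) h
    simp only [Complex.ofReal_cpow (by norm_num : (0 : ℝ) ≤ 2)] at h2
    push_cast at h2
    exact h2.symm
  have h := localCocyclicZeta_two_mul hs hx
  have hne := local_two_denom_ne_zero hs hx
  refine mul_right_cancel₀ hne (h.trans ?_)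
  push_cast
  generalize ((√2 : ℝ) : ℂ) = y at hy
  have h3 : y ^ 3 = 2 * y := by linear_combination y * hy
  have h4 : y ^ 4 = 4 := by linear_combination (y ^ 2 + 2) * hy
  have h5 : y ^ 5 = 4 * y := by linear_combination y * h4
  have h8 : y ^ 8 = 16 := by linear_combination (y ^ 4 + 4) * h4
  have h10 : y ^ 10 = 32 := by linear_combination y ^ 8 * hy + 2 * h8
  simp only [div_pow, h3, h4, h5, h8, h10, hy]
  linear_combination (5 / 32) * hy

/-! ### Splitting off the Dirichlet series `ζ(2s - 2)` -/

open Classical in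
/-- The arithmetic function `n ↦ n` on squares and `0` elsewhere; its Dirichlet series is
`ζ(2s - 2)`. -/
noncomputable def squareId : ArithmeticFunction ℂ :=
  ⟨fun n => if IsSquare n then (n : ℂ) else 0, by simp⟩

lemma squareId_apply (n : ℕ) [Decidable (IsSquare n)] :
    squareId n = if IsSquare n then (n : ℂ) else 0 := by
  rw [squareId, ArithmeticFunction.coe_mk]
  congr

lemma Nat.Coprime.isSquare_mul_iff {m n : ℕ} (h : Nat.Coprime m n) :
    IsSquare (m * n) ↔ IsSquare m ∧ IsSquare n := by
  constructor
  · intro hs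
    obtain ⟨r, hr⟩ := (isSquare_iff_exists_sq _).1 hs
    obtain ⟨a, ha⟩ := exists_eq_pow_of_mul_eq_pow (Nat.isUnit_iff.2 h) hr
    obtain ⟨b, hb⟩ := exists_eq_pow_of_mul_eq_pow (Nat.isUnit_iff.2 h.symm)
      ((mul_comm n m).trans hr)
    exact ⟨(isSquare_iff_exists_sq _).2 ⟨a, ha⟩, (isSquare_iff_exists_sq _).2 ⟨b, hb⟩⟩
  · rintro ⟨h1, h2⟩
    exact h1.mul h2

lemma squareId_isMultiplicative : squareId.IsMultiplicative := by
  classical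
  refine ⟨by simp [squareId_apply], fun {m n} h => ?_⟩
  simp only [squareId_apply, h.isSquare_mul_iff]
  by_cases h1 : IsSquare m <;> by_cases h2 : IsSquare n <;> simp [h1, h2]

lemma Nat.Prime.isSquare_pow_add_two_iff {p : ℕ} (hp : p.Prime) (m : ℕ) :
    IsSquare (p ^ (m + 2)) ↔ IsSquare (p ^ m) := by
  constructor
  · rintro ⟨r, hr⟩
    have hpr : p ∣ r := by
      have : p ∣ r * r := hr ▸ dvd_pow_self p (by omega)
      exact (hp.dvd_mul.1 this).elim id id
    obtain ⟨s, rfl⟩ := hpr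
    refine ⟨s, Nat.eq_of_mul_eq_mul_left (pow_pos hp.pos 2) ?_⟩
    linarith [show p ^ 2 * p ^ m = p ^ (m + 2) by ring]
  · rintro ⟨r, hr⟩
    exact ⟨p * r, by rw [pow_add, hr]; ring⟩

/-- The Dirichlet inverse of `squareId`: multiplicative, `-p²` at `p²`, and `0` at all other
prime powers `pᵉ` with `e > 0`. -/
noncomputable def squareIdInv : ArithmeticFunction ℂ :=
  ⟨fun n => if n = 0 then 0 else n.factorization.prod
    fun p e => if e = 0 then 1 else if e = 2 then -(p : ℂ) ^ 2 else 0, by simp⟩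

lemma squareIdInv_isMultiplicative : squareIdInv.IsMultiplicative := by
  refine ⟨by simp [squareIdInv], fun {m n} h => ?_⟩
  simp only [squareIdInv, ArithmeticFunction.coe_mk]
  rcases eq_or_ne m 0 with rfl | hm
  · simp
  rcases eq_or_ne n 0 with rfl | hn
  · simp
  rw [if_neg (mul_ne_zero hm hn), if_neg hm, if_neg hn, Nat.factorization_mul_of_coprime h,
    Finsupp.prod_add_index_of_disjoint (by
      simpa using h.disjoint_primeFactors)]

lemma squareIdInv_prime_pow {p : ℕ} (hp : p.Prime) (e : ℕ) :
    squareIdInv (p ^ e) = if e = 0 then 1 else if e = 2 then -(p : ℂ) ^ 2 else 0 := by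
  simp only [squareIdInv, ArithmeticFunction.coe_mk]
  rw [if_neg (pow_ne_zero e hp.ne_zero), hp.factorization_pow, Finsupp.prod_single_index (by simp)]

lemma mul_apply_prime_pow {f g : ArithmeticFunction ℂ} {p : ℕ} (hp : p.Prime) (m : ℕ) :
    (f * g) (p ^ m) = ∑ i ∈ Finset.range (m + 1), f (p ^ i) * g (p ^ (m - i)) := by
  rw [ArithmeticFunction.mul_apply, Nat.sum_divisorsAntidiagonal fun x y => f x * g y,
    Nat.sum_divisors_prime_pow hp]
  refine Finset.sum_congr rfl fun i hi => ?_
  rw [Nat.pow_div (by have := Finset.mem_range.1 hi; omega) hp.pos]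

lemma squareIdInv_mul_prime_pow_add_two (f : ArithmeticFunction ℂ) {p : ℕ} (hp : p.Prime) (m : ℕ) :
    (squareIdInv * f) (p ^ (m + 2)) = f (p ^ (m + 2)) - (p : ℂ) ^ 2 * f (p ^ m) := by
  rw [mul_apply_prime_pow hp]
  have : ∀ i ∈ Finset.range (m + 2 + 1), squareIdInv (p ^ i) * f (p ^ (m + 2 - i))
      = (if i = 0 then f (p ^ (m + 2)) else 0)
        + (if i = 2 then -(p : ℂ) ^ 2 * f (p ^ m) else 0) := by
    intro i _
    rw [squareIdInv_prime_pow hp]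
    by_cases h0 : i = 0
    · subst h0; simp
    · by_cases h2 : i = 2
      · subst h2; simp
      · simp [h0, h2]
  rw [Finset.sum_congr rfl this, Finset.sum_add_distrib, Finset.sum_ite_eq' _ 0,
    Finset.sum_ite_eq' _ 2, if_pos (by simp), if_pos (by simp)]
  ring

lemma squareIdInv_mul_prime (f : ArithmeticFunction ℂ) {p : ℕ} (hp : p.Prime) :
    (squareIdInv * f) (p ^ 1) = f (p ^ 1) := by
  rw [mul_apply_prime_pow hp, Finset.sum_range_succ, Finset.sum_range_one,
    squareIdInv_prime_pow hp, squareIdInv_prime_pow hp]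
  simp

lemma squareIdInv_mul_squareId : squareIdInv * squareId = 1 := by
  classical
  rw [(squareIdInv_isMultiplicative.mul squareId_isMultiplicative).eq_iff_eq_on_prime_powers _ _
    ArithmeticFunction.isMultiplicative_one]
  intro p i hp
  rcases i with _ | _ | m
  · rw [pow_zero, (squareIdInv_isMultiplicative.mul squareId_isMultiplicative).1,
      ArithmeticFunction.one_one]
  · rw [zero_add, squareIdInv_mul_prime _ hp, squareId_apply, pow_one,
      if_neg (fun h => (Nat.prime_iff.1 hp).not_isSquare h),
      ArithmeticFunction.one_apply_ne hp.ne_one]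
  · rw [squareIdInv_mul_prime_pow_add_two _ hp, squareId_apply, squareId_apply,
      ArithmeticFunction.one_apply_ne (Nat.one_lt_pow (by omega) hp.one_lt).ne']
    by_cases h : IsSquare (p ^ m)
    · rw [if_pos h, if_pos ((hp.isSquare_pow_add_two_iff m).2 h)]
      push_cast
      ring
    · rw [if_neg h, if_neg (fun h' => h ((hp.isSquare_pow_add_two_iff m).1 h'))]
      ring

lemma squareIdInv_mul_mul_squareId (f : ArithmeticFunction ℂ) :
    (squareIdInv * f) * squareId = f := by
  rw [mul_right_comm, squareIdInv_mul_squareId, one_mul]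

lemma summable_norm_squareIdInv_mul {f : ArithmeticFunction ℂ} {p : ℕ} (hp : p.Prime) {x : ℂ}
    (hf : Summable fun m => ‖f (p ^ m) * x ^ m‖) :
    Summable fun m => ‖(squareIdInv * f) (p ^ m) * x ^ m‖ := by
  rw [← summable_nat_add_iff 2]
  refine Summable.of_nonneg_of_le (fun _ => norm_nonneg _) (fun m => ?_)
    (((summable_nat_add_iff 2).2 hf).add (hf.mul_left ‖(p : ℂ) ^ 2 * x ^ 2‖))
  rw [squareIdInv_mul_prime_pow_add_two f hp, ← norm_mul]
  refine le_trans (le_of_eq ?_) (norm_sub_le _ _)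
  congr 1
  ring

/-- On local series, `squareIdInv * ·` is multiplication by `1 - p²x²`. -/
lemma tsum_squareIdInv_mul {f : ArithmeticFunction ℂ} {p : ℕ} (hp : p.Prime) {x : ℂ}
    (hf : Summable fun m => ‖f (p ^ m) * x ^ m‖) :
    ∑' m, (squareIdInv * f) (p ^ m) * x ^ m
      = (1 - (p : ℂ) ^ 2 * x ^ 2) * ∑' m, f (p ^ m) * x ^ m := by
  have hh := (summable_norm_squareIdInv_mul hp hf).of_norm
  have hf' := hf.of_norm
  have h1 := hh.sum_add_tsum_nat_add 2
  have h2 := hf'.sum_add_tsum_nat_add 2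
  have e0 : (squareIdInv * f) (p ^ 0) = f (p ^ 0) := by
    rw [mul_apply_prime_pow hp]
    simp [squareIdInv]
  have h3 : ∑' m, (squareIdInv * f) (p ^ (m + 2)) * x ^ (m + 2)
      = ∑' m, f (p ^ (m + 2)) * x ^ (m + 2) - (p : ℂ) ^ 2 * x ^ 2 * ∑' m, f (p ^ m) * x ^ m := by
    rw [← tsum_mul_left, ← ((summable_nat_add_iff 2).2 hf').tsum_sub (hf'.mul_left _)]
    refine tsum_congr fun m => ?_
    rw [squareIdInv_mul_prime_pow_add_two f hp]
    ring
  simp only [Finset.sum_range_succ, Finset.sum_range_zero, e0, squareIdInv_mul_prime f hp] at h1 h2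
  linear_combination -h1 + h2 + h3

/-! ### Absolute convergence from the prime powers -/

/-- A nonnegative multiplicative function is summable if its sums over the prime powers `pᵉ`,
`e ≥ 1`, are bounded by a summable function of `p`. -/
lemma summable_of_prime_powers {F B : ℕ → ℝ} (hF : ∀ n, 0 ≤ F n) (hF0 : F 0 = 0) (hF1 : F 1 = 1)
    (hmul : ∀ {m n : ℕ}, Nat.Coprime m n → F (m * n) = F m * F n)
    (hs : ∀ p : ℕ, p.Prime → Summable fun e => F (p ^ e))
    (hB0 : ∀ p, 0 ≤ B p) (hB : Summable B)
    (hFB : ∀ p : ℕ, p.Prime → ∑' e, F (p ^ (e + 1)) ≤ B p) : Summable F := by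
  refine summable_of_sum_range_le (c := Real.exp (∑' p, B p)) hF fun N => ?_
  obtain ⟨-, h⟩ := EulerProduct.summable_and_hasSum_smoothNumbers_prod_primesBelow_tsum hF1 hmul
    (fun {p} hp => by simpa only [Real.norm_of_nonneg (hF _)] using hs p hp) N
  have h' : HasSum ((N.smoothNumbers).indicator F) (∏ p ∈ N.primesBelow, ∑' n, F (p ^ n)) :=
    hasSum_subtype_iff_indicator.1 h
  calc ∑ n ∈ Finset.range N, F n
      = ∑ n ∈ Finset.range N, (N.smoothNumbers).indicator F n := by
        refine Finset.sum_congr rfl fun n hn => ?_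
        rcases Nat.eq_zero_or_pos n with rfl | hpos
        · rw [hF0, Set.indicator_apply, hF0, ite_self]
        · rw [Set.indicator_of_mem (Nat.mem_smoothNumbers_of_lt hpos (Finset.mem_range.1 hn))]
    _ ≤ ∏ p ∈ N.primesBelow, ∑' n, F (p ^ n) :=
        sum_le_hasSum _ (fun n _ => Set.indicator_nonneg (fun n _ => hF n) n) h'
    _ ≤ ∏ p ∈ N.primesBelow, Real.exp (B p) := by
        refine Finset.prod_le_prod (fun p _ => tsum_nonneg fun _ => hF _) fun p hp => ?_
        have hp' := Nat.prime_of_mem_primesBelow hp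
        rw [(hs p hp').tsum_eq_zero_add, pow_zero, hF1, add_comm]
        exact (add_le_add_left (hFB p hp') 1).trans (Real.add_one_le_exp _)
    _ = Real.exp (∑ p ∈ N.primesBelow, B p) := (Real.exp_sum _ _).symm
    _ ≤ Real.exp (∑' p, B p) := Real.exp_le_exp.2 (hB.sum_le_tsum _ fun p _ => hB0 p)

/-- A multiplicative function with the values of `cocyclicCount` at the powers of the odd primes,
and bounded by it at the powers of `2`. Both `cocyclicCount` and its restriction to odd arguments
are of this kind. -/
structure IsCocyclicLike (f : ArithmeticFunction ℂ) : Prop where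
  isMultiplicative : f.IsMultiplicative
  odd_prime_pow : ∀ p : ℕ, p.Prime → p ≠ 2 → ∀ m, f (p ^ m) = cocyclicCount (p ^ m)
  norm_two_pow_le : ∀ m, ‖f (2 ^ m)‖ ≤ cocyclicCount (2 ^ m)

lemma term_prime_pow (f : ℕ → ℂ) (s : ℂ) {p : ℕ} (hp : p.Prime) (m : ℕ) :
    LSeries.term f s (p ^ m) = f (p ^ m) * ((p : ℂ) ^ (-s)) ^ m := by
  rw [LSeries.term_of_ne_zero (pow_ne_zero m hp.ne_zero), natCast_pow_cpow, Complex.cpow_neg,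
    inv_pow, div_eq_mul_inv]

lemma term_mul_of_coprime {f : ArithmeticFunction ℂ} (hf : f.IsMultiplicative) (s : ℂ) {m n : ℕ}
    (h : Nat.Coprime m n) :
    LSeries.term f s (m * n) = LSeries.term f s m * LSeries.term f s n := by
  rcases eq_or_ne m 0 with rfl | hm
  · simp
  rcases eq_or_ne n 0 with rfl | hn
  · simp
  rw [LSeries.term_of_ne_zero hm, LSeries.term_of_ne_zero hn,
    LSeries.term_of_ne_zero (mul_ne_zero hm hn), hf.2 h, Nat.cast_mul,
    Complex.natCast_mul_natCast_cpow, mul_div_mul_comm]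

namespace IsCocyclicLike

variable {f : ArithmeticFunction ℂ}

lemma summable_local (hf : IsCocyclicLike f) {p : ℕ} (hp : p.Prime) {x : ℂ}
    (hx : ‖(p : ℂ) * x‖ < 1) : Summable fun m => ‖f (p ^ m) * x ^ m‖ := by
  refine Summable.of_nonneg_of_le (fun _ => norm_nonneg _) (fun m => ?_) (summable_norm_local hp hx)
  rw [norm_mul, norm_mul, Complex.norm_natCast]
  refine mul_le_mul_of_nonneg_right ?_ (norm_nonneg _)
  rcases eq_or_ne p 2 with rfl | hp2
  · exact hf.norm_two_pow_le m
  · rw [hf.odd_prime_pow p hp hp2, Complex.norm_natCast]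

lemma quotient_prime (hf : IsCocyclicLike f) {p : ℕ} (hp : p.Prime) (hp2 : p ≠ 2) :
    (squareIdInv * f) (p ^ 1) = 1 := by
  rw [squareIdInv_mul_prime f hp, hf.odd_prime_pow p hp hp2, pow_one, cocyclicCount_prime hp,
    Nat.cast_one]

lemma quotient_prime_sq (hf : IsCocyclicLike f) {p : ℕ} (hp : p.Prime) (hp2 : p ≠ 2) :
    (squareIdInv * f) (p ^ 2) = 0 := by
  rw [squareIdInv_mul_prime_pow_add_two f hp 0, hf.odd_prime_pow p hp hp2,
    hf.odd_prime_pow p hp hp2, cocyclicCount_odd_prime_pow_succ hp hp2, pow_zero, cocyclicCount_one]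
  norm_num
  ring

lemma norm_quotient_le (hf : IsCocyclicLike f) {p : ℕ} (hp : p.Prime) (hp2 : p ≠ 2) (j : ℕ) :
    ‖(squareIdInv * f) (p ^ (j + 3))‖ ≤ (p : ℝ) ^ (j + 3) := by
  rw [show j + 3 = (j + 1) + 2 by ring, squareIdInv_mul_prime_pow_add_two f hp,
    hf.odd_prime_pow p hp hp2, hf.odd_prime_pow p hp hp2, show j + 1 + 2 = (j + 2) + 1 by ring,
    cocyclicCount_odd_prime_pow_succ hp hp2, cocyclicCount_odd_prime_pow_succ hp hp2]
  have hp1 : (1 : ℝ) ≤ p := by exact_mod_cast hp.one_lt.le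
  have hE : (((j + 2 + 1) / 2 : ℕ) : ℤ) - (((j + 2 + 4) / 4 : ℕ) : ℤ)
      = (((j + 1) / 2 : ℕ) : ℤ) - (((j + 4) / 4 : ℕ) : ℤ) ∨
      (((j + 2 + 1) / 2 : ℕ) : ℤ) - (((j + 2 + 4) / 4 : ℕ) : ℤ)
      = (((j + 1) / 2 : ℕ) : ℤ) - (((j + 4) / 4 : ℕ) : ℤ) + 1 := by omega
  rcases hE with hE | hE <;> rw [hE]
  · rw [show ∀ E : ℂ, (p : ℂ) ^ (j + 2) * (p + E * (p - 1)) - p ^ 2 * (p ^ j * (p + E * (p - 1)))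
      = 0 from fun E => by ring, norm_zero]
    positivity
  · push_cast
    rw [show ∀ E : ℂ, (p : ℂ) ^ (j + 2) * (p + (E + 1) * (p - 1))
      - p ^ 2 * (p ^ j * (p + E * (p - 1))) = ((p ^ (j + 2) * (p - 1) : ℝ) : ℂ) from
        fun E => by push_cast; ring, Complex.norm_real, Real.norm_of_nonneg
        (mul_nonneg (by positivity) (by linarith)), pow_succ _ (j + 2)]
    gcongr
    linarith

/-- The quotient of `f` by `squareId` has a Dirichlet series converging absolutely beyond
`Re s = 3/2`. At an odd prime `p` its coefficients are `1, 1, 0` followed by terms of size at most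
`pᵉ`, so the local series differs from `1` by `O(p^{-σ} + p^{3 - 3σ})`. -/
lemma summable_quotient (hf : IsCocyclicLike f) {s : ℂ} (hs : 4 / 3 < s.re) :
    LSeriesSummable ⇑(squareIdInv * f) s := by
  set h := squareIdInv * f with hh
  have hmul : h.IsMultiplicative := squareIdInv_isMultiplicative.mul hf.isMultiplicative
  set σ := s.re with hσ
  set F : ℕ → ℝ := fun n => ‖LSeries.term h s n‖ with hFdef
  have hFpow : ∀ p : ℕ, p.Prime → ∀ e, F (p ^ e) = ‖h (p ^ e) * ((p : ℂ) ^ (-s)) ^ e‖ :=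
    fun p hp e => by simp only [hFdef, term_prime_pow _ _ hp]
  have hsum : ∀ p : ℕ, p.Prime → Summable fun e => F (p ^ e) := fun p hp => by
    simp only [hFpow p hp]
    exact summable_norm_squareIdInv_mul hp
      (hf.summable_local hp (norm_prime_mul_cpow_lt_one hp (by linarith)))
  set u : ℝ := (2 : ℝ) ^ (1 - σ) with hu
  have hu1 : u < 1 := Real.rpow_lt_one_of_one_lt_of_neg one_lt_two (by linarith)
  set B : ℕ → ℝ := fun p => (p : ℝ) ^ (-σ) + (p : ℝ) ^ (3 - 3 * σ) * (1 - u)⁻¹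
    + if p = 2 then ∑' e, F (2 ^ (e + 1)) else 0 with hBdef
  have hF0 : ∀ n, 0 ≤ F n := fun n => norm_nonneg _
  have h2nn : 0 ≤ ∑' e, F (2 ^ (e + 1)) := tsum_nonneg fun _ => hF0 _
  have hmain : ∀ p : ℕ, 0 ≤ (p : ℝ) ^ (-σ) + (p : ℝ) ^ (3 - 3 * σ) * (1 - u)⁻¹ := fun p =>
    add_nonneg (Real.rpow_nonneg (Nat.cast_nonneg p) _)
      (mul_nonneg (Real.rpow_nonneg (Nat.cast_nonneg p) _) (inv_nonneg.2 (by linarith)))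
  have hBsum : Summable B := by
    refine ((Real.summable_nat_rpow.2 (by linarith)).add
      ((Real.summable_nat_rpow.2 (by linarith)).mul_right _)).add ?_
    exact (hasSum_ite_eq 2 _).summable
  have key : Summable F := by
    refine summable_of_prime_powers hF0 (by simp [hFdef]) ?_ ?_ hsum (B := B) ?_ hBsum ?_
    · simp [hFdef, hmul.1]
    · intro m n hmn
      simp only [hFdef, term_mul_of_coprime hmul s hmn, norm_mul]
    · intro p
      refine add_nonneg (hmain p) ?_
      split_ifs
      exacts [h2nn, le_rfl]
    · intro p hp
      rcases eq_or_ne p 2 with rfl | hp2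
      · simp only [hBdef, if_true]
        linarith [hmain 2]
      · simp only [hBdef, if_neg hp2, add_zero]
        have hp0 : (0 : ℝ) < p := by exact_mod_cast hp.pos
        have hx : ‖(p : ℂ) ^ (-s)‖ = (p : ℝ) ^ (-σ) := by
          rw [Complex.norm_natCast_cpow_of_pos hp.pos, Complex.neg_re]
        set v : ℝ := (p : ℝ) ^ (1 - σ) with hv
        have hv0 : 0 ≤ v := Real.rpow_nonneg hp0.le _
        have hvx : (p : ℝ) * (p : ℝ) ^ (-σ) = v := by
          rw [hv, sub_eq_add_neg, Real.rpow_add hp0, Real.rpow_one]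
        have hvu : v ≤ u :=
          Real.rpow_le_rpow_of_nonpos two_pos (by exact_mod_cast hp.two_le) (by linarith)
        have hv3 : (p : ℝ) ^ (3 - 3 * σ) = v ^ 3 := by
          rw [hv, ← Real.rpow_natCast, ← Real.rpow_mul hp0.le]
          congr 1
          push_cast
          ring
        have hs1 := (summable_nat_add_iff 1).2 (hsum p hp)
        have hs3 := (summable_nat_add_iff 3).2 (hsum p hp)
        have hv1 : v < 1 := hvu.trans_lt hu1
        have hgeo := (summable_geometric_of_lt_one hv0 hv1).mul_left (v ^ 3)
        rw [← hs1.sum_add_tsum_nat_add 2, hv3]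
        simp only [Finset.sum_range_succ, Finset.sum_range_zero]
        have e1 : F (p ^ (0 + 1)) = (p : ℝ) ^ (-σ) := by
          rw [hFpow p hp, zero_add, hf.quotient_prime hp hp2, one_mul, pow_one, hx]
        have e2 : F (p ^ (1 + 1)) = 0 := by
          rw [hFpow p hp, hf.quotient_prime_sq hp hp2, zero_mul, norm_zero]
        rw [e1, e2, zero_add, add_zero]
        refine add_le_add_right ?_ _
        calc ∑' e, F (p ^ (e + 2 + 1)) ≤ ∑' e, v ^ 3 * v ^ e := by
              refine hs3.tsum_le_tsum (fun e => ?_) hgeo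
              rw [hFpow p hp, norm_mul, norm_pow, hx, ← pow_add, add_comm 3 e, ← hvx, mul_pow]
              exact mul_le_mul_of_nonneg_right (hf.norm_quotient_le hp hp2 e) (by positivity)
          _ = v ^ 3 * (1 - v)⁻¹ := by rw [tsum_mul_left, tsum_geometric_of_lt_one hv0 hv1]
          _ ≤ v ^ 3 * (1 - u)⁻¹ := by
              refine mul_le_mul_of_nonneg_left ?_ (by positivity)
              exact inv_anti₀ (by linarith) (by linarith)
  exact key.of_norm

end IsCocyclicLike

/-! ### The Dirichlet series of `squareId` and the analytic continuation -/

lemma term_squareId_sq {s : ℂ} (hs : s ≠ 1) (n : ℕ) :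
    LSeries.term squareId s (n ^ 2) = 1 / (n : ℂ) ^ (2 * s - 2) := by
  classical
  rcases eq_or_ne n 0 with rfl | hn
  · rw [Nat.cast_zero, Complex.zero_cpow (fun h => hs (by linear_combination h / 2))]
    simp
  · have hn' : (n : ℂ) ≠ 0 := Nat.cast_ne_zero.2 hn
    rw [LSeries.term_of_ne_zero (pow_ne_zero 2 hn), squareId_apply, if_pos (IsSquare.sq n),
      natCast_pow_cpow, Complex.cpow_sub _ _ hn', Complex.cpow_ofNat_mul,
      Complex.cpow_ofNat]
    have : (n : ℂ) ^ s ≠ 0 := by simp [Complex.cpow_eq_zero_iff, hn']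
    push_cast
    field_simp

lemma hasSum_squareId {s : ℂ} (hs : 3 / 2 < s.re) :
    LSeriesHasSum squareId s (riemannZeta (2 * s - 2)) := by
  classical
  have hre : 1 < (2 * s - 2).re := by
    simp only [Complex.sub_re, Complex.mul_re, Complex.re_ofNat, Complex.im_ofNat]
    linarith
  have hs1 : s ≠ 1 := fun h => by rw [h, Complex.one_re] at hs; norm_num at hs
  have hinj : Function.Injective fun n : ℕ => n ^ 2 := Nat.pow_left_injective two_ne_zero
  rw [LSeriesHasSum, ← hinj.hasSum_iff, zeta_eq_tsum_one_div_nat_cpow hre]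
  · have : LSeries.term squareId s ∘ (fun n : ℕ => n ^ 2)
        = fun n : ℕ => 1 / (n : ℂ) ^ (2 * s - 2) := funext fun n => term_squareId_sq hs1 n
    rw [this]
    exact (Complex.summable_one_div_nat_cpow.2 hre).hasSum
  · intro n hn
    have hns : ¬ IsSquare n := fun h => hn (by
      obtain ⟨r, hr⟩ := (isSquare_iff_exists_sq n).1 h
      exact ⟨r, hr.symm⟩)
    rw [LSeries.term_def, squareId_apply, if_neg hns, zero_div, ite_self]

namespace IsCocyclicLike

variable {f : ArithmeticFunction ℂ}

lemma hasSum (hf : IsCocyclicLike f) {s : ℂ} (hs : 3 / 2 < s.re) :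
    LSeriesHasSum f s (riemannZeta (2 * s - 2) * LSeries ⇑(squareIdInv * f) s) := by
  have h := ArithmeticFunction.LSeriesHasSum_mul
    (hf.summable_quotient (by linarith : 4 / 3 < s.re)).LSeriesHasSum (hasSum_squareId hs)
  rwa [squareIdInv_mul_mul_squareId, mul_comm] at h

lemma analyticOnNhd_quotient (hf : IsCocyclicLike f) :
    AnalyticOnNhd ℂ (LSeries ⇑(squareIdInv * f)) {s | 4 / 3 < s.re} := by
  refine (LSeries_analyticOnNhd _).mono fun s hs => ?_
  have h : LSeries.abscissaOfAbsConv ⇑(squareIdInv * f) ≤ ((4 / 3 : ℝ) : EReal) :=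
    LSeries.abscissaOfAbsConv_le_of_forall_lt_LSeriesSummable fun y hy =>
      hf.summable_quotient (by simpa using hy)
  exact h.trans_lt (by exact_mod_cast hs)

/-- `ζ(2s - 2)` times the analytic factor is analytic on `Re s > 4/3` away from `3/2`. -/
lemma analyticOnNhd_continuation (hf : IsCocyclicLike f) :
    AnalyticOnNhd ℂ (fun s => riemannZeta (2 * s - 2) * LSeries ⇑(squareIdInv * f) s)
      ({s : ℂ | 4 / 3 < s.re} \ {3 / 2}) := by
  intro s hs
  refine AnalyticAt.mul ?_ (hf.analyticOnNhd_quotient s hs.1)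
  have h1 : AnalyticAt ℂ riemannZeta (2 * s - 2) := analyticOn_riemannZeta _ fun h =>
    hs.2 (by
      rw [Set.mem_singleton_iff] at h ⊢
      linear_combination h / 2)
  have h2 : AnalyticAt ℂ (fun s : ℂ => 2 * s - 2) s := by fun_prop
  exact AnalyticAt.fun_comp h1 h2

end IsCocyclicLike

/-- A function analytic on a punctured neighbourhood of `a` with nonzero residue limit
`(s - a) F(s) → c` has a simple pole at `a`. -/
lemma meromorphicOrderAt_of_tendsto {F : ℂ → ℂ} {a c : ℂ} {U : Set ℂ} (hU : IsOpen U)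
    (ha : a ∈ U) (hF : AnalyticOnNhd ℂ F (U \ {a})) (hc : c ≠ 0)
    (h : Tendsto (fun s => (s - a) * F s) (nhdsWithin a {a}ᶜ) (nhds c)) :
    meromorphicOrderAt F a = -1 := by
  let G : ℂ → ℂ := Function.update (fun s => (s - a) * F s) a c
  have hGF : ∀ s, s ≠ a → G s = (s - a) * F s := fun s hs => Function.update_of_ne hs _ _
  have hGa : G a = c := Function.update_self _ _ _
  have hUn : U ∈ nhds a := hU.mem_nhds ha
  have hG : AnalyticAt ℂ G a := by
    refine Complex.analyticAt_of_differentiable_on_punctured_nhds_of_continuousAt ?_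
      (continuousAt_update_same.2 h)
    filter_upwards [nhdsWithin_le_nhds hUn, self_mem_nhdsWithin] with s hs hsa
    have hd : DifferentiableAt ℂ (fun s => (s - a) * F s) s :=
      (by fun_prop : DifferentiableAt ℂ (fun s => s - a) s).mul (hF s ⟨hs, hsa⟩).differentiableAt
    refine hd.congr_of_eventuallyEq ?_
    filter_upwards [isOpen_compl_singleton.mem_nhds hsa] with z hz using hGF z hz
  have hFG : ∀ᶠ z in nhdsWithin a {a}ᶜ, F z = (z - a) ^ (-1 : ℤ) • G z := by
    filter_upwards [self_mem_nhdsWithin] with z hz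
    have hz0 : z - a ≠ 0 := sub_ne_zero.2 hz
    rw [hGF z hz, smul_eq_mul, zpow_neg_one, inv_mul_cancel_left₀ hz0]
  have hmer : MeromorphicAt F a :=
    (((MeromorphicAt.id a).sub (MeromorphicAt.const a a)).zpow (-1) |>.smul
      hG.meromorphicAt).congr (hFG.mono fun z hz => hz.symm)
  have := (meromorphicOrderAt_eq_int_iff (n := -1) hmer).2 ⟨G, hG, hGa ▸ hc, hFG⟩
  simpa using this

lemma IsCocyclicLike.meromorphicOrderAt_continuation {f : ArithmeticFunction ℂ}
    (hf : IsCocyclicLike f) (hne : LSeries ⇑(squareIdInv * f) (3 / 2) ≠ 0) :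
    meromorphicOrderAt (fun s => riemannZeta (2 * s - 2) * LSeries ⇑(squareIdInv * f) s) (3 / 2)
      = -1 := by
  have hmem : (3 / 2 : ℂ) ∈ {s : ℂ | 4 / 3 < s.re} := by
    rw [Set.mem_ofPred_eq]; norm_num
  refine meromorphicOrderAt_of_tendsto (isOpen_lt continuous_const Complex.continuous_re) hmem
    hf.analyticOnNhd_continuation (c := 1 / 2 * LSeries ⇑(squareIdInv * f) (3 / 2))
    (mul_ne_zero (by norm_num) hne) ?_
  have h1 : Tendsto (fun s : ℂ => 2 * s - 2) (nhdsWithin (3 / 2) {3 / 2}ᶜ)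
      (nhdsWithin 1 {1}ᶜ) := by
    refine tendsto_nhdsWithin_iff.2 ⟨?_, ?_⟩
    · have : ContinuousAt (fun s : ℂ => 2 * s - 2) (3 / 2) := by fun_prop
      have h := this.tendsto
      norm_num at h
      exact h.mono_left nhdsWithin_le_nhds
    · filter_upwards [self_mem_nhdsWithin] with s hs h
      rw [Set.mem_singleton_iff] at h
      exact hs (by rw [Set.mem_singleton_iff]; linear_combination h / 2)
  have h2 := (riemannZeta_residue_one.comp h1).const_mul (1 / 2 : ℂ)
  have h3 : Tendsto (LSeries ⇑(squareIdInv * f)) (nhdsWithin (3 / 2) {3 / 2}ᶜ)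
      (nhds (LSeries ⇑(squareIdInv * f) (3 / 2))) :=
    (hf.analyticOnNhd_quotient _ hmem).continuousAt.tendsto.mono_left nhdsWithin_le_nhds
  refine ((h2.mul h3).congr fun s => ?_).trans_eq ?_
  · simp only [Function.comp_apply]
    ring
  · rw [mul_one]

/-! ### Summatory functions -/

/-- The sum of the squares `n² ≤ y`, in closed form. -/
noncomputable def squareSum (y : ℝ) : ℝ :=
  (⌊√y⌋₊ : ℝ) * (⌊√y⌋₊ + 1) * (2 * ⌊√y⌋₊ + 1) / 6

lemma sum_Ioc_sq (q : ℕ) : ∑ n ∈ Finset.Ioc 0 q, ((n : ℂ) ^ 2) = q * (q + 1) * (2 * q + 1) / 6 := by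
  induction q with
  | zero => simp
  | succ q ih =>
    rw [Finset.sum_Ioc_succ_top (Nat.zero_le q), ih]
    push_cast
    ring

lemma sum_squareId {y : ℝ} (hy : 0 ≤ y) :
    ∑ e ∈ Finset.Ioc 0 ⌊y⌋₊, squareId e = (squareSum y : ℂ) := by
  classical
  have hle : ∀ n : ℕ, n ^ 2 ≤ ⌊y⌋₊ ↔ n ≤ ⌊√y⌋₊ := fun n => by
    rw [Nat.le_floor_iff hy, Nat.le_floor_iff (Real.sqrt_nonneg y),
      Real.le_sqrt (Nat.cast_nonneg n) hy, Nat.cast_pow]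
  have himg : (Finset.Ioc 0 ⌊y⌋₊).filter IsSquare = (Finset.Ioc 0 ⌊√y⌋₊).image fun n => n ^ 2 := by
    ext e
    simp only [Finset.mem_filter, Finset.mem_Ioc, Finset.mem_image]
    constructor
    · rintro ⟨⟨h0, h1⟩, h2⟩
      obtain ⟨r, rfl⟩ := (isSquare_iff_exists_sq e).1 h2
      exact ⟨r, ⟨Nat.pos_of_ne_zero (by rintro rfl; simp at h0), (hle r).1 h1⟩, rfl⟩
    · rintro ⟨r, ⟨h0, h1⟩, rfl⟩
      exact ⟨⟨pow_pos h0 2, (hle r).2 h1⟩, IsSquare.sq r⟩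
  simp only [squareId_apply]
  rw [← Finset.sum_filter, himg, Finset.sum_image fun a _ b _ h =>
    Nat.pow_left_injective two_ne_zero h]
  simp only [Nat.cast_pow]
  rw [sum_Ioc_sq, squareSum]
  push_cast
  ring

lemma squareSum_nonneg (y : ℝ) : 0 ≤ squareSum y := by
  unfold squareSum
  positivity

lemma rpow_three_halves {y : ℝ} (hy : 0 ≤ y) : y ^ (3 / 2 : ℝ) = √y ^ 3 := by
  rw [Real.sqrt_eq_rpow, ← Real.rpow_natCast, ← Real.rpow_mul hy]
  norm_num

lemma squareSum_le {y : ℝ} (hy : 0 ≤ y) : squareSum y ≤ y ^ (3 / 2 : ℝ) := by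
  rw [rpow_three_halves hy, squareSum]
  have h := Nat.floor_le (Real.sqrt_nonneg y)
  refine le_trans ?_ (pow_le_pow_left₀ (Nat.cast_nonneg _) h 3)
  rcases Nat.eq_zero_or_pos ⌊√y⌋₊ with h0 | h0
  · simp [h0]
  · have h1 : (1 : ℝ) ≤ ⌊√y⌋₊ := by exact_mod_cast h0
    generalize (⌊√y⌋₊ : ℝ) = q at *
    nlinarith [mul_nonneg (sub_nonneg.2 h1) (by linarith : 0 ≤ q),
      pow_nonneg (by linarith : 0 ≤ q) 2]

lemma tendsto_squareSum :
    Tendsto (fun y : ℝ => squareSum y / y ^ (3 / 2 : ℝ)) atTop (nhds (1 / 3)) := by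
  have h1 : Tendsto (fun z : ℝ => (⌊z⌋₊ : ℝ) / z) atTop (nhds 1) := tendsto_nat_floor_div_atTop
  have h2 : Tendsto (fun z : ℝ => z⁻¹) atTop (nhds 0) := tendsto_inv_atTop_zero
  have h3 := ((h1.mul (h1.add h2)).mul ((h1.const_mul 2).add h2)).div_const 6
  norm_num at h3
  refine (h3.comp Real.tendsto_sqrt_atTop).congr' ?_
  filter_upwards [eventually_gt_atTop 0] with y hy
  have hz : √y ≠ 0 := (Real.sqrt_pos.2 hy).ne'
  rw [rpow_three_halves hy.le, squareSum, Function.comp_apply]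
  field_simp

/-- Summing the convolution `(squareIdInv * f) * squareId = f` over one factor first. -/
lemma sum_eq_tsum_squareSum (f : ArithmeticFunction ℂ) {T : ℝ} (hT : 0 ≤ T) :
    ∑ k ∈ Finset.Icc 1 ⌊T⌋₊, f k = ∑' d : ℕ, (squareIdInv * f) d * (squareSum (T / d) : ℂ) := by
  rw [tsum_eq_sum (s := Finset.Ioc 0 ⌊T⌋₊)]
  · change ∑ k ∈ Finset.Ioc 0 ⌊T⌋₊, f k = _
    conv_lhs => rw [← squareIdInv_mul_mul_squareId f]
    rw [ArithmeticFunction.sum_Ioc_mul_eq_sum_sum]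
    refine Finset.sum_congr rfl fun d _ => ?_
    rw [← Nat.floor_div_natCast, sum_squareId (div_nonneg hT (Nat.cast_nonneg d))]
  · intro d hd
    rcases Nat.eq_zero_or_pos d with rfl | hpos
    · simp
    · have hlt : ⌊T⌋₊ < d := by
        by_contra! h
        exact hd (Finset.mem_Ioc.2 ⟨hpos, h⟩)
      have h1 : T / d < 1 := (div_lt_one (by exact_mod_cast hpos)).2 (Nat.lt_of_floor_lt hlt)
      have h2 : ⌊√(T / d)⌋₊ = 0 :=
        Nat.floor_eq_zero.2 ((Real.sqrt_lt' one_pos).2 (by simpa using h1))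
      rw [squareSum, h2]
      simp

/-- By dominated convergence (Tannery), with `squareSum y ≤ y ^ (3 / 2)` as the bound, the constant
in `∑_{k ≤ T} f(k) ∼ c T ^ (3 / 2)` is a third of the Dirichlet series of `squareIdInv * f` at
`3 / 2`. -/
lemma IsCocyclicLike.tendsto_sum_div {f : ArithmeticFunction ℂ} (hf : IsCocyclicLike f) :
    Tendsto (fun T : ℝ => (∑ k ∈ Finset.Icc 1 ⌊T⌋₊, f k) / ((T ^ (3 / 2 : ℝ) : ℝ) : ℂ)) atTop
      (nhds (LSeries ⇑(squareIdInv * f) (3 / 2) / 3)) := by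
  set h := squareIdInv * f with hh
  have hsum : LSeriesSummable h (3 / 2) := hf.summable_quotient (by norm_num)
  have hterm : ∀ d : ℕ, LSeries.term h (3 / 2) d = h d * (((d : ℝ) ^ (3 / 2 : ℝ) : ℝ) : ℂ)⁻¹ := by
    intro d
    rcases eq_or_ne d 0 with rfl | hd
    · simp
    · rw [LSeries.term_of_ne_zero hd, Complex.ofReal_cpow (Nat.cast_nonneg d), div_eq_mul_inv]
      push_cast
      rfl
  have hlim : Tendsto (fun T : ℝ => ∑' d : ℕ,
      LSeries.term h (3 / 2) d * ((squareSum (T / d) / (T / d) ^ (3 / 2 : ℝ) : ℝ) : ℂ)) atTop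
      (nhds (∑' d : ℕ, LSeries.term h (3 / 2) d * ((1 / 3 : ℝ) : ℂ))) := by
    refine tendsto_tsum_of_dominated_convergence hsum.norm (fun d => ?_) ?_
    · rcases eq_or_ne d 0 with rfl | hd
      · simp
      · refine Tendsto.const_mul _ ((Complex.continuous_ofReal.tendsto _).comp ?_)
        have hd0 : (0 : ℝ) < d := by exact_mod_cast Nat.pos_of_ne_zero hd
        exact tendsto_squareSum.comp (tendsto_id.atTop_div_const hd0)
    · filter_upwards [eventually_ge_atTop 0] with T hT d
      rw [norm_mul, Complex.norm_real]
      refine mul_le_of_le_one_right (norm_nonneg _) ?_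
      have hTd : 0 ≤ T / d := div_nonneg hT (Nat.cast_nonneg d)
      rw [Real.norm_of_nonneg (div_nonneg (squareSum_nonneg _) (Real.rpow_nonneg hTd _))]
      exact div_le_one_of_le₀ (squareSum_le hTd) (Real.rpow_nonneg hTd _)
  have hval : ∑' d : ℕ, LSeries.term h (3 / 2) d * ((1 / 3 : ℝ) : ℂ) = LSeries h (3 / 2) / 3 := by
    rw [tsum_mul_right, LSeries]
    push_cast
    ring
  rw [hval] at hlim
  refine hlim.congr' ?_
  filter_upwards [eventually_gt_atTop 0] with T hT
  rw [sum_eq_tsum_squareSum f hT.le, ← hh, ← tsum_div_const]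
  refine tsum_congr fun d => ?_
  rw [hterm]
  rcases eq_or_ne d 0 with rfl | hd
  · simp
  · have hd0 : (0 : ℝ) < d := by exact_mod_cast Nat.pos_of_ne_zero hd
    rw [Real.div_rpow hT.le hd0.le]
    have h1 : ((T ^ (3 / 2 : ℝ) : ℝ) : ℂ) ≠ 0 := by exact_mod_cast (Real.rpow_pos_of_pos hT _).ne'
    have h2 : (((d : ℝ) ^ (3 / 2 : ℝ) : ℝ) : ℂ) ≠ 0 := by
      exact_mod_cast (Real.rpow_pos_of_pos hd0 _).ne'
    rw [Complex.ofReal_div, Complex.ofReal_div]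
    field_simp

/-! ### The Euler product at `3/2` -/

lemma summable_eulerFactor_sub_one :
    Summable fun p : {p : ℕ // p.Prime ∧ p ≠ 2} => eulerFactor p - 1 := by
  have h : Summable fun n : ℕ => 2 * (n : ℝ) ^ (-(3 / 2) : ℝ) - (n : ℝ) ^ (-(5 / 2) : ℝ)
      - (n : ℝ) ^ (-3 : ℝ) - (n : ℝ) ^ (-(7 / 2) : ℝ) :=
    ((((Real.summable_nat_rpow.2 (by norm_num)).mul_left 2).sub
      (Real.summable_nat_rpow.2 (by norm_num))).sub (Real.summable_nat_rpow.2 (by norm_num))).sub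
      (Real.summable_nat_rpow.2 (by norm_num))
  refine (h.comp_injective Subtype.val_injective).congr fun p => ?_
  simp only [Function.comp_apply, eulerFactor]
  ring

lemma multipliable_eulerFactor :
    Multipliable fun p : {p : ℕ // p.Prime ∧ p ≠ 2} => eulerFactor p := by
  simpa using Real.multipliable_one_add_of_summable summable_eulerFactor_sub_one

lemma one_le_eulerFactor {p : ℕ} (hp : p.Prime) (hp2 : p ≠ 2) : 1 ≤ eulerFactor p := by
  have hp3 : (3 : ℝ) ≤ p := by
    have := hp.two_le
    exact_mod_cast (by omega : 3 ≤ p)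
  have hp0 : (0 : ℝ) < p := by linarith
  have hp1 : (1 : ℝ) ≤ p := by linarith
  have h1 : (p : ℝ) ^ (-3 : ℝ) ≤ (p : ℝ) ^ (-(5 / 2) : ℝ) :=
    Real.rpow_le_rpow_of_exponent_le hp1 (by norm_num)
  have h2 : (p : ℝ) ^ (-(7 / 2) : ℝ) ≤ (p : ℝ) ^ (-(5 / 2) : ℝ) :=
    Real.rpow_le_rpow_of_exponent_le hp1 (by norm_num)
  have h3 : (p : ℝ) ^ (-(3 / 2) : ℝ) = p * (p : ℝ) ^ (-(5 / 2) : ℝ) := by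
    nth_rw 2 [← Real.rpow_one (p : ℝ)]
    rw [← Real.rpow_add hp0]
    norm_num
  have h4 : 0 ≤ (p : ℝ) ^ (-(5 / 2) : ℝ) := Real.rpow_nonneg hp0.le _
  rw [eulerFactor, h3]
  nlinarith

lemma one_le_tprod_eulerFactor :
    1 ≤ ∏' p : {p : ℕ // p.Prime ∧ p ≠ 2}, eulerFactor p := by
  refine ge_of_tendsto' multipliable_eulerFactor.hasProd fun s => ?_
  exact Finset.prod_induction _ (fun z : ℝ => 1 ≤ z)
    (fun a b ha hb => one_le_mul_of_one_le_of_one_le ha hb)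
    le_rfl fun p _ => one_le_eulerFactor p.2.1 p.2.2

/-- At an odd prime, the local factor at `3/2` divided by that of `ζ(2s - 2)` is the Euler factor
of the statement times the local factor of `ζ(2)`. -/
lemma local_three_halves {p : ℕ} (hp : p.Prime) (hp2 : p ≠ 2) {x : ℂ}
    (hx : x = (p : ℂ) ^ (-(3 / 2 : ℂ))) :
    (1 - (p : ℂ) ^ 2 * x ^ 2) * ∑' m, (cocyclicCount (p ^ m) : ℂ) * x ^ m
      = (1 - (p : ℂ) ^ (-2 : ℂ))⁻¹ * (eulerFactor p : ℂ) := by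
  have hp0 : (0 : ℝ) < p := by exact_mod_cast hp.pos
  have hpc : (p : ℂ) ≠ 0 := by exact_mod_cast hp.ne_zero
  have hs : 1 < (3 / 2 : ℂ).re := by norm_num
  have hlt := norm_prime_mul_cpow_lt_one hp hs
  rw [← hx] at hlt
  have hmul := local_odd_mul hp hp2 hlt
  have hne := one_sub_pow_ne_zero hlt four_ne_zero
  rw [mul_pow] at hne
  set y : ℝ := (p : ℝ) ^ (-(3 / 2) : ℝ) with hy
  have hxy : x = (y : ℂ) := by
    rw [hx, hy, Complex.ofReal_cpow hp0.le]
    push_cast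
    rfl
  have hyy : y ^ 2 = ((p : ℝ) ^ 3)⁻¹ := by
    rw [hy, ← Real.rpow_natCast, ← Real.rpow_mul hp0.le, ← Real.rpow_natCast,
      ← Real.rpow_neg hp0.le]
    norm_num
  have hxx : x ^ 2 = ((p : ℂ) ^ 3)⁻¹ := by
    rw [hxy, ← Complex.ofReal_pow, hyy]
    push_cast
    rfl
  have e5 : (p : ℝ) ^ (-(5 / 2) : ℝ) = y * (p : ℝ)⁻¹ := by
    rw [hy, ← Real.rpow_neg_one (p : ℝ), ← Real.rpow_add hp0]
    norm_num
  have e7 : (p : ℝ) ^ (-(7 / 2) : ℝ) = y * ((p : ℝ) ^ 2)⁻¹ := by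
    rw [hy, ← Real.rpow_natCast, ← Real.rpow_neg hp0.le, ← Real.rpow_add hp0]
    norm_num
  have e3 : (p : ℝ) ^ (-3 : ℝ) = ((p : ℝ) ^ 3)⁻¹ := by
    rw [← Real.rpow_natCast, ← Real.rpow_neg hp0.le]
    norm_num
  have heuler : (eulerFactor p : ℂ) = 1 + 2 * x - x * (p : ℂ)⁻¹ - ((p : ℂ) ^ 3)⁻¹
      - x * ((p : ℂ) ^ 2)⁻¹ := by
    rw [eulerFactor, e5, e7, e3, ← hy, hxy]
    push_cast
    ring
  have e2 : (p : ℂ) ^ (-2 : ℂ) = ((p : ℂ) ^ 2)⁻¹ := by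
    rw [Complex.cpow_neg, Complex.cpow_ofNat]
  have hx3 : x ^ 3 = x * ((p : ℂ) ^ 3)⁻¹ := by rw [← hxx]; ring
  have hx4 : x ^ 4 = ((p : ℂ) ^ 6)⁻¹ := by
    rw [show x ^ 4 = x ^ 2 * x ^ 2 by ring, hxx, ← mul_inv, ← pow_add]
  have hx5 : x ^ 5 = x * ((p : ℂ) ^ 6)⁻¹ := by rw [← hx4]; ring
  have e44 : (p : ℂ) ^ 4 * x ^ 4 = ((p : ℂ) ^ 2)⁻¹ := by
    rw [hx4]
    field_simp
  rw [e44] at hne hmul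
  rw [e2, heuler, eq_inv_mul_iff_mul_eq₀ hne]
  refine (Eq.trans (by ring) hmul).trans ?_
  rw [hx3, hx4, hx5]
  field_simp
  ring

/-- The Euler product of `squareIdInv * f` at `3 / 2`. The factor `3 / 8` is
`(1 - 2⁻¹) (1 - 2⁻²)`: the first comes from `squareIdInv`, the second completes `ζ(2)`. -/
lemma IsCocyclicLike.quotient_three_halves {f : ArithmeticFunction ℂ} (hf : IsCocyclicLike f) :
    LSeries ⇑(squareIdInv * f) (3 / 2) = riemannZeta 2 *
      (3 / 8 * (∑' m, f (2 ^ m) * ((2 : ℂ) ^ (-(3 / 2 : ℂ))) ^ m) *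
        ((∏' p : {p : ℕ // p.Prime ∧ p ≠ 2}, eulerFactor p : ℝ) : ℂ)) := by
  classical
  set h := squareIdInv * f with hh
  have hmul : h.IsMultiplicative := squareIdInv_isMultiplicative.mul hf.isMultiplicative
  have hs : 1 < (3 / 2 : ℂ).re := by norm_num
  have hsum : LSeriesSummable h (3 / 2) := hf.summable_quotient (by norm_num)
  have hprod : HasProd (fun p : Nat.Primes => ∑' e, LSeries.term h (3 / 2) (p ^ e))
      (LSeries h (3 / 2)) :=
    EulerProduct.eulerProduct_hasProd
      (by rw [LSeries.term_of_ne_zero one_ne_zero, hmul.1]; simp)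
      (fun {m n} hmn => term_mul_of_coprime hmul _ hmn) hsum.norm (LSeries.term_zero _ _)
  have hlocal : ∀ p : ℕ, p.Prime → ∑' e, LSeries.term h (3 / 2) (p ^ e)
      = (1 - (p : ℂ) ^ 2 * ((p : ℂ) ^ (-(3 / 2 : ℂ))) ^ 2)
        * ∑' m, f (p ^ m) * ((p : ℂ) ^ (-(3 / 2 : ℂ))) ^ m := by
    intro p hp
    rw [← tsum_squareIdInv_mul hp (hf.summable_local hp (norm_prime_mul_cpow_lt_one hp hs))]
    exact tsum_congr fun e => term_prime_pow _ _ hp e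
  set P := ∏' p : {p : ℕ // p.Prime ∧ p ≠ 2}, eulerFactor p with hP
  set L := 3 / 8 * ∑' m, f (2 ^ m) * ((2 : ℂ) ^ (-(3 / 2 : ℂ))) ^ m with hL
  have hodd : HasProd (Set.mulIndicator {p : ℕ | p.Prime ∧ p ≠ 2} fun p => (eulerFactor p : ℂ))
      (P : ℂ) := by
    rw [← hasProd_subtype_iff_mulIndicator]
    exact multipliable_eulerFactor.hasProd.map Complex.ofRealHom Complex.continuous_ofReal
  have hQ : HasProd (fun p : Nat.Primes => if (p : ℕ) = 2 then L else (eulerFactor p : ℂ))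
      (L * P) := by
    have h2 := (hasProd_ite_eq 2 L).mul hodd
    refine (hasProd_subtype_iff_mulIndicator (s := {p : ℕ | p.Prime})
      (f := fun p : ℕ => if p = 2 then L else (eulerFactor p : ℂ))).2 ?_
    convert h2 using 2 with p
    by_cases hp2 : p = 2
    · subst hp2
      simp [Set.mulIndicator, Nat.prime_two]
    · by_cases hp : p.Prime <;> simp [Set.mulIndicator, hp, hp2]
  have hζ := (riemannZeta_eulerProduct_hasProd (s := 2) (by norm_num)).mul hQ
  refine hprod.unique ?_
  convert hζ using 2 with p
  rw [hlocal p p.2]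
  split_ifs with hp2
  · rw [hp2, hL]
    have hx2 : ((2 : ℂ) ^ (-(3 / 2 : ℂ))) ^ 2 = 1 / 8 := by
      rw [← Complex.cpow_mul_nat]
      norm_num
      rw [Complex.cpow_neg, show (3 : ℂ) = ((3 : ℕ) : ℂ) by norm_num, Complex.cpow_natCast]
      norm_num
    have e2 : (2 : ℂ) ^ (-2 : ℂ) = 1 / 4 := by
      rw [Complex.cpow_neg, Complex.cpow_ofNat]
      norm_num
    push_cast
    rw [hx2, e2]
    ring
  · rw [tsum_congr fun m => by rw [hf.odd_prime_pow p p.2 hp2 m]]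
    exact local_three_halves p.2 hp2 rfl

/-! ### All indices and odd indices -/

/-- `cocyclicCount` as an arithmetic function. -/
noncomputable def cocyclicArith : ArithmeticFunction ℂ :=
  ⟨fun k => (cocyclicCount k : ℂ), by simp [cocyclicCount_zero]⟩

/-- `cocyclicCount` restricted to odd indices, as an arithmetic function. -/
noncomputable def oddCocyclicArith : ArithmeticFunction ℂ :=
  ⟨fun k => if Odd k then (cocyclicCount k : ℂ) else 0, by simp⟩

lemma cocyclicArith_apply (k : ℕ) : cocyclicArith k = (cocyclicCount k : ℂ) := rfl

lemma oddCocyclicArith_apply (k : ℕ) :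
    oddCocyclicArith k = if Odd k then (cocyclicCount k : ℂ) else 0 := rfl

lemma oddCocyclicArith_two_pow (m : ℕ) : oddCocyclicArith (2 ^ m) = if m = 0 then 1 else 0 := by
  rcases m with _ | m
  · simp [oddCocyclicArith_apply, cocyclicCount_one]
  · simp [oddCocyclicArith_apply, Nat.odd_pow_iff]

lemma isCocyclicLike_cocyclicArith : IsCocyclicLike cocyclicArith where
  isMultiplicative := ⟨by simp [cocyclicArith_apply, cocyclicCount_one], fun {m n} h => by
    simp [cocyclicArith_apply, cocyclicCount_mul h]⟩
  odd_prime_pow _ _ _ _ := rfl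
  norm_two_pow_le m := by rw [cocyclicArith_apply, Complex.norm_natCast]

lemma isCocyclicLike_oddCocyclicArith : IsCocyclicLike oddCocyclicArith where
  isMultiplicative := ⟨by simp [oddCocyclicArith_apply, cocyclicCount_one], fun {m n} h => by
    simp only [oddCocyclicArith_apply, cocyclicCount_mul h, Nat.odd_mul]
    by_cases h1 : Odd m <;> by_cases h2 : Odd n <;> simp [h1, h2]⟩
  odd_prime_pow p hp hp2 m := by
    rw [oddCocyclicArith_apply, if_pos (hp.odd_of_ne_two hp2).pow]
  norm_two_pow_le m := by
    rw [oddCocyclicArith_two_pow]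
    split_ifs with h
    · simp [h, cocyclicCount_one]
    · simp

lemma sum_cocyclicArith (T : ℝ) :
    ∑ k ∈ Finset.Icc 1 ⌊T⌋₊, cocyclicArith k = ((cocyclicUpTo T : ℝ) : ℂ) := by
  simp [cocyclicArith_apply, cocyclicUpTo]

lemma sum_oddCocyclicArith (T : ℝ) :
    ∑ k ∈ Finset.Icc 1 ⌊T⌋₊, oddCocyclicArith k = ((oddCocyclicUpTo T : ℝ) : ℂ) := by
  rw [oddCocyclicUpTo, Finset.sum_filter]
  push_cast
  exact Finset.sum_congr rfl fun k _ => by rw [oddCocyclicArith_apply]; split_ifs <;> simp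

lemma riemannZeta_two_eq_re : riemannZeta 2 = ((riemannZeta 2).re : ℂ) := by
  rw [riemannZeta_two, ← Complex.ofReal_pow, ← Complex.ofReal_ofNat, ← Complex.ofReal_div,
    Complex.ofReal_re]

lemma riemannZeta_two_re_pos : 0 < (riemannZeta 2).re := by
  have h : riemannZeta 2 = ((Real.pi ^ 2 / 6 : ℝ) : ℂ) := by
    rw [riemannZeta_two]
    push_cast
    rfl
  rw [h, Complex.ofReal_re]
  positivity

/-- The asymptotics of a summatory function, from a real value `C > 0` of the `2`-adic factor. -/
lemma IsCocyclicLike.isEquivalent {f : ArithmeticFunction ℂ} (hf : IsCocyclicLike f) {N : ℝ → ℕ}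
    (hN : ∀ T : ℝ, ∑ k ∈ Finset.Icc 1 ⌊T⌋₊, f k = ((N T : ℝ) : ℂ)) {C : ℝ} (hC : 0 < C)
    (h2 : ∑' m, f (2 ^ m) * ((2 : ℂ) ^ (-(3 / 2 : ℂ))) ^ m = ((8 * C : ℝ) : ℂ)) :
    (fun T : ℝ => (N T : ℝ)) ~[atTop] fun T : ℝ => ((riemannZeta 2).re * C *
      ∏' p : {p : ℕ // p.Prime ∧ p ≠ 2}, eulerFactor p) * T ^ (3 / 2 : ℝ) := by
  set P := ∏' p : {p : ℕ // p.Prime ∧ p ≠ 2}, eulerFactor p with hP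
  have hc : (riemannZeta 2).re * C * P ≠ 0 :=
    (mul_pos (mul_pos riemannZeta_two_re_pos hC)
      (one_pos.trans_le one_le_tprod_eulerFactor)).ne'
  have hlim := hf.tendsto_sum_div
  rw [hf.quotient_three_halves, h2, riemannZeta_two_eq_re, ← hP] at hlim
  simp only [hN] at hlim
  have hval : ((riemannZeta 2).re : ℂ) * (3 / 8 * ((8 * C : ℝ) : ℂ) * (P : ℂ)) / 3
      = (((riemannZeta 2).re * C * P : ℝ) : ℂ) := by
    push_cast
    ring
  rw [hval] at hlim
  have hre : Tendsto (fun T : ℝ => (N T : ℝ) / T ^ (3 / 2 : ℝ)) atTop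
      (nhds ((riemannZeta 2).re * C * P)) := by
    refine ((Complex.continuous_re.tendsto _).comp hlim).congr fun T => ?_
    rw [Function.comp_apply, ← Complex.ofReal_div, Complex.ofReal_re]
  have hpos : ∀ᶠ T : ℝ in atTop, ((riemannZeta 2).re * C * P) * T ^ (3 / 2 : ℝ) ≠ 0 := by
    filter_upwards [eventually_gt_atTop 0] with T hT
    exact mul_ne_zero hc (Real.rpow_pos_of_pos hT _).ne'
  rw [isEquivalent_iff_tendsto_one hpos]
  have h1 := hre.div_const ((riemannZeta 2).re * C * P)
  rw [div_self hc] at h1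
  refine h1.congr fun T => ?_
  rw [Pi.div_apply, div_div, mul_comm (T ^ (3 / 2 : ℝ))]

lemma tsum_cocyclicArith_two_pow :
    ∑' m, cocyclicArith (2 ^ m) * ((2 : ℂ) ^ (-(3 / 2 : ℂ))) ^ m = localCocyclicZeta 2 (3 / 2) := by
  simp only [localCocyclicZeta, localTerm_eq, cocyclicArith_apply, Nat.cast_ofNat]

theorem theorem2 :
    -- the counting function is a genuine (finite) count
    (∀ k : ℕ, 1 ≤ k → (cocyclicSubrings k).Finite) ∧
    -- the local factors at odd primes
    (∀ p : ℕ, p.Prime → p ≠ 2 → ∀ s : ℂ, 1 < s.re → ∀ x : ℂ, x = (p : ℂ) ^ (-s) →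
      Summable (localTerm p s) ∧
      (1 - (p : ℂ) ^ 2 * x ^ 2) * (1 - (p : ℂ) ^ 4 * x ^ 4) ≠ 0 ∧
      localCocyclicZeta p s =
        (1 + x + ((p : ℂ) ^ 3 - (p : ℂ) ^ 2) * x ^ 3 - (p : ℂ) ^ 3 * x ^ 4 - (p : ℂ) ^ 4 * x ^ 5) /
          ((1 - (p : ℂ) ^ 2 * x ^ 2) * (1 - (p : ℂ) ^ 4 * x ^ 4))) ∧
    -- the local factor at `2`
    (∀ s : ℂ, 1 < s.re → ∀ x : ℂ, x = (2 : ℂ) ^ (-s) →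
      Summable (localTerm 2 s) ∧
      (1 - 2 ^ 4 * x ^ 4) * (1 - 2 ^ 3 * x ^ 3) ≠ 0 ∧
      localCocyclicZeta 2 s =
        (1 + x + 2 ^ 2 * x ^ 2 - 2 ^ 3 * x ^ 4 - 2 ^ 4 * x ^ 5 + 2 ^ 7 * x ^ 8 + 2 ^ 10 * x ^ 10) /
          ((1 - 2 ^ 4 * x ^ 4) * (1 - 2 ^ 3 * x ^ 3))) ∧
    -- the zeta function converges for `Re s > 3/2`, and continues to a larger half-plane with
    -- a simple pole at `3/2` and no other singularity
    (∀ s : ℂ, 3 / 2 < s.re → LSeriesSummable (fun k => (cocyclicCount k : ℂ)) s) ∧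
    (∃ δ : ℝ, 0 < δ ∧ ∃ F : ℂ → ℂ,
      (∀ s : ℂ, 3 / 2 < s.re → F s = cocyclicZeta s) ∧
      AnalyticOnNhd ℂ F ({s : ℂ | 3 / 2 - δ < s.re} \ {3 / 2}) ∧
      meromorphicOrderAt F (3 / 2) = -1) ∧
    -- the product over the odd primes converges
    Multipliable (fun p : {p : ℕ // p.Prime ∧ p ≠ 2} => eulerFactor p) ∧
    -- the asymptotics over all indices, with `A = 7/24`, `B = 5/48`
    (∃ A B : ℚ, A = 7 / 24 ∧ B = 5 / 48 ∧
      localCocyclicZeta 2 (3 / 2) / 8 = (((A : ℝ) + (B : ℝ) * √2 : ℝ) : ℂ) ∧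
      (fun T : ℝ => (cocyclicUpTo T : ℝ)) ~[atTop]
        (fun T : ℝ => ((riemannZeta 2).re * ((A : ℝ) + (B : ℝ) * √2) *
          ∏' p : {p : ℕ // p.Prime ∧ p ≠ 2}, eulerFactor p) * T ^ (3 / 2 : ℝ))) ∧
    -- the asymptotics over odd indices: the `2`-adic factor is absent
    (fun T : ℝ => (oddCocyclicUpTo T : ℝ)) ~[atTop]
      (fun T : ℝ => ((riemannZeta 2).re * (1 / 8) *
        ∏' p : {p : ℕ // p.Prime ∧ p ≠ 2}, eulerFactor p) * T ^ (3 / 2 : ℝ)) := by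
  have hf := isCocyclicLike_cocyclicArith
  refine ⟨fun k hk => cocyclicSubrings_finite (by omega), ?_, ?_, ?_, ?_,
    multipliable_eulerFactor, ?_, ?_⟩
  · intro p hp hp2 s hs x hx
    have hne := local_odd_denom_ne_zero hp hs hx
    exact ⟨summable_localTerm hp hs, hne,
      (eq_div_iff hne).2 (localCocyclicZeta_odd_mul hp hp2 hs hx)⟩
  · intro s hs x hx
    have hne := local_two_denom_ne_zero hs hx
    exact ⟨summable_localTerm Nat.prime_two hs, hne,
      (eq_div_iff hne).2 (localCocyclicZeta_two_mul hs hx)⟩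
  · exact fun s hs => (hf.hasSum hs).LSeriesSummable
  · refine ⟨1 / 6, by norm_num,
      fun s => riemannZeta (2 * s - 2) * LSeries ⇑(squareIdInv * cocyclicArith) s,
      fun s hs => (hf.hasSum hs).LSeries_eq.symm, ?_, hf.meromorphicOrderAt_continuation ?_⟩
    · norm_num
      exact hf.analyticOnNhd_continuation
    · rw [hf.quotient_three_halves, tsum_cocyclicArith_two_pow, localCocyclicZeta_two_three_halves,
        riemannZeta_two_eq_re]
      have h1 := riemannZeta_two_re_pos.ne'
      have h2 : (7 / 3 + 5 / 6 * √2 : ℝ) ≠ 0 := by positivity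
      have h3 := (one_pos.trans_le one_le_tprod_eulerFactor).ne'
      exact mul_ne_zero (by exact_mod_cast h1)
        (mul_ne_zero (mul_ne_zero (by norm_num) (by exact_mod_cast h2)) (by exact_mod_cast h3))
  · refine ⟨7 / 24, 5 / 48, rfl, rfl, ?_, ?_⟩
    · rw [localCocyclicZeta_two_three_halves]
      push_cast
      ring
    · refine hf.isEquivalent sum_cocyclicArith (by push_cast; positivity) ?_
      rw [tsum_cocyclicArith_two_pow, localCocyclicZeta_two_three_halves]
      push_cast
      ring
  · refine isCocyclicLike_oddCocyclicArith.isEquivalent sum_oddCocyclicArith (by norm_num) ?_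
    rw [tsum_eq_single 0 fun m hm => by rw [oddCocyclicArith_two_pow, if_neg hm, zero_mul],
      oddCocyclicArith_two_pow]
    norm_num
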